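/- Let $n\ge 2$, and let $D_n$ be the group of permutations of $\{-n,\dots,-1,1,\dots,n\}$ generated by $S=\{s_{1'},s_1,\dots,s_{n-1}\}$, where $s_i=(-i-1,\,-i)(i,\,i+1)$ and $s_{1'}=(-2,\,1)(-1,\,2)$. For $J\subseteq S$ let $W_J=\langle J\rangle$, and let $\mathcal X_J\in\mathbb Z[D_n]$ be the sum of all elements that have minimal length (with respect to $S$) in their left coset $wW_J$. Let $\mathcal Z$ be the subring of $\mathbb Z[D_n]$ generated by all $\mathcal X_J$. For a prime $p$, the $p$-modular descent algebra is the $\mathbb F_p$-algebra $\Sigma(D_n,p)=\mathcal Z/p\mathcal Z$. A composition $\kappa=[\kappa_1,\dots,\kappa_k]$ of $m\ge 0$ is a list of positive integers (its components) with sum $m$; $[\ ]$ is the composition of $0$. Let $\mathcal C(n)$ be the disjoint union of the set $\mathcal C_{<n}$ of compositions of all $m\le n-2$, the set $\mathcal C_1$ of compositions of $n$ with $\kappa_1=1$, the set $\mathcal C_n$ of compositions of $n$ with $\kappa_1\ge 2$, and a second copy $\mathcal C_n'=\{\kappa^\vee : \kappa\in\mathcal C_n\}$ of the latter, where $\kappa^\vee$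 has the same components as $\kappa$. To $\kappa\in\mathcal C(n)$ associate the following subset $J_\kappa\subseteq S$: * if $\kappa\in\mathcal C_{<n}$ is a composition of $m$: $\{s_{n-m+\kappa_1+\dots+\kappa_j} : 0\le j\le k-1\}$; * if $\kappa\in\mathcal C_1$ or $\kappa\in\mathcal C_n$: $\{s_{1'}\}\cup\{s_{\kappa_1+\dots+\kappa_j} : 1\le j\le k-1\}$; * if $\kappa\in\mathcal C_n'$: $\{s_1\}\cup\{s_{\kappa_1+\dots+\kappa_j} : 1\le j\le k-1\}$. Put $B_\kappa=\mathcal X_{S\setminus J_\kappa}$, and let $\overline B_\kappa$ be its image in $\Sigma(D_n,p)$. Write $\kappa\approx\nu$ if the components of $\nu$ are a reordering of those of $\kappa$, except when one of $\kappa,\nu$ is in $\mathcal C_n$, the other is in $\mathcal C_n'$, and all components are even. **Theorem.** The $B_\kappa$, $\kappa\in\mathcal C(n)$, span $\mathcal Z$ over $\mathbb Z$. The (Jacobson) radical of $\Sigma(D_n,p)$ is the $\mathbb F_p$-span of the following elements. 1. If $p\ne 2$: all $\overline B_\kappa-\overline B_\nu$ with $\kappa\approx\nu$, together with all $\overline B_\kappa$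 such that some integer occurs at least $p$ times among the components of $\kappa$. 2. If $p=2$ and $n$ is even: all $\overline B_\kappa$ with $\kappa\ne[\ ]$. 3. If $p=2$ and $n$ is odd: all $\overline B_\kappa$ with $\kappa\notin\{[\ ],[n],[n]^\vee\}$, together with $\overline B_{[n]}-\overline B_{[n]^\vee}$. -/

import Mathlib

namespace TypeD

/-- The set `{-n, …, -1, 1, …, n}`. -/
abbrev SignedPoint (n : ℕ) : Type := {z : ℤ // z ≠ 0 ∧ -(n : ℤ) ≤ z ∧ z ≤ n}

instance (n : ℕ) : Finite (SignedPoint n) :=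
  ((Set.finite_Icc (-(n : ℤ)) n).subset fun _ hz => ⟨hz.2.1, hz.2.2⟩).to_subtype

/-- The Coxeter generators, indexed by `Fin n`: the index `0` stands for the generator
`s_{1'} = (-2, 1)(-1, 2)`, and an index `i ∈ {1, …, n - 1}` for
`s_i = (-i - 1, -i)(i, i + 1)`. (For `n ≤ 1` there is no `s_{1'}`; the value is then `1`.) -/
def simpleReflection (n : ℕ) (i : Fin n) : Equiv.Perm (SignedPoint n) :=
  if _h : (i : ℕ) = 0 then
    if _hn : 2 ≤ n then
      Equiv.swap ⟨-2, by omega⟩ ⟨1, by omega⟩ * Equiv.swap ⟨-1, by omega⟩ ⟨2, by omega⟩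
    else 1
  else
    Equiv.swap ⟨-(i : ℤ) - 1, by omega⟩ ⟨-(i : ℤ), by omega⟩ *
      Equiv.swap ⟨(i : ℤ), by omega⟩ ⟨(i : ℤ) + 1, by omega⟩

/-- The Coxeter group `D_n`, as a group of permutations of `{-n, …, -1, 1, …, n}`. -/
def coxeterGroup (n : ℕ) : Subgroup (Equiv.Perm (SignedPoint n)) :=
  Subgroup.closure (Set.range (simpleReflection n))

instance (n : ℕ) : Finite (coxeterGroup n) := by
  unfold coxeterGroup; infer_instance

/-- The generators as elements of `D_n`. -/
def gen (n : ℕ) (i : Fin n) : coxeterGroup n :=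
  ⟨simpleReflection n i, Subgroup.subset_closure ⟨i, rfl⟩⟩

/-- The Coxeter length: the least length of a word in the generators that represents `w`. -/
noncomputable def length {n : ℕ} (w : coxeterGroup n) : ℕ :=
  sInf {k : ℕ | ∃ l : List (Fin n), l.length = k ∧ (l.map (gen n)).prod = w}

/-- The subgroup `W_J` generated by the generators with index in `J`. -/
def parabolic {n : ℕ} (J : Set (Fin n)) : Subgroup (coxeterGroup n) :=
  Subgroup.closure (gen n '' J)

/-- `X_J`: the elements of minimal length in their left coset `w W_J`. -/
def minReps {n : ℕ} (J : Set (Fin n)) : Set (coxeterGroup n) :=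
  {w | ∀ u ∈ parabolic J, length w ≤ length (w * u)}

/-- The formal sum of the elements of `X_J`, in the integral group ring of `D_n`. -/
noncomputable def repSum {n : ℕ} (J : Set (Fin n)) : MonoidAlgebra ℤ (coxeterGroup n) :=
  ∑ w ∈ (Set.toFinite (minReps J)).toFinset, MonoidAlgebra.of ℤ (coxeterGroup n) w

/-- The integral descent ring of `D_n`, as the subring of the group ring generated by the sums
`repSum J`. By a theorem of Solomon it is just their `ℤ`-span; the main theorem asserts this as
well, and no definition relies on it. -/
noncomputable def descentRing (n : ℕ) : Subring (MonoidAlgebra ℤ (coxeterGroup n)) :=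
  Subring.closure (Set.range fun J : Set (Fin n) => repSum J)

/-- The ideal of all multiples of `p` in the integral descent ring. -/
def multiples (n p : ℕ) : Ideal (descentRing n) where
  carrier := {x | ∃ y, x = p • y}
  zero_mem' := ⟨0, by simp⟩
  add_mem' := by
    rintro _ _ ⟨a, rfl⟩ ⟨b, rfl⟩
    exact ⟨a + b, by simp⟩
  smul_mem' := by
    rintro c _ ⟨a, rfl⟩
    exact ⟨c * a, by rw [smul_eq_mul, mul_smul_comm]⟩

instance (n p : ℕ) : (multiples n p).IsTwoSided where
  mul_mem_of_left := by
    rintro _ b ⟨a, rfl⟩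
    exact ⟨a * b, by rw [smul_mul_assoc]⟩

/-- The `p`-modular descent algebra `Σ(D_n, p)`. -/
abbrev ModularDescentAlgebra (n p : ℕ) : Type := descentRing n ⧸ multiples n p

/-- `Σ(D_n, p)` is a vector space over `𝔽_p`. -/
noncomputable instance (n p : ℕ) : Module (ZMod p) (ModularDescentAlgebra n p) :=
  AddCommGroup.zmodModule (n := p) fun x => by
    obtain ⟨y, rfl⟩ := Ideal.Quotient.mk_surjective x
    have h : Ideal.Quotient.mk (multiples n p) (p • y) = 0 :=
      Ideal.Quotient.eq_zero_iff_mem.mpr ⟨y, rfl⟩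
    rw [nsmul_eq_mul, map_mul, map_natCast] at h
    rwa [nsmul_eq_mul]

/-- The multiset `𝒞(n)`, a disjoint union of four sets of compositions:
* `below`: the compositions of the integers `m ≤ n - 2`;
* `one`: the compositions of `n` with first component `1`;
* `top`: the compositions of `n` with first component at least `2`;
* `dual`: a second copy of the preceding set, whose members are written `κ^∨`. -/
inductive DComposition (n : ℕ) : Type
  | below (m : ℕ) (hm : m + 2 ≤ n) (c : Composition m)
  | one (c : Composition n) (h : ∃ a ∈ c.blocks.head?, a = 1)
  | top (c : Composition n) (h : ∃ a ∈ c.blocks.head?, 2 ≤ a)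
  | dual (c : Composition n) (h : ∃ a ∈ c.blocks.head?, 2 ≤ a)

namespace DComposition

/-- The list of components. -/
def components {n : ℕ} : DComposition n → List ℕ
  | below _ _ c => c.blocks
  | one c _ => c.blocks
  | top c _ => c.blocks
  | dual c _ => c.blocks

/-- Membership in the first copy `𝒞_n`. -/
def IsTop {n : ℕ} : DComposition n → Prop
  | top _ _ => True
  | _ => False

/-- Membership in the second copy `𝒞_n'`. -/
def IsDual {n : ℕ} : DComposition n → Prop
  | dual _ _ => True
  | _ => False

/-- The subset of the generators that corresponds to a member of `𝒞(n)`; recall that the index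
`0` stands for `s_{1'}`, and that `c.sizeUpTo j` is the sum of the first `j` components. -/
def subset {n : ℕ} : DComposition n → Set (Fin n)
  | below m _ c => {i | ∃ j < c.length, (i : ℕ) = (n - m) + c.sizeUpTo j}
  | one c _ => {i | (i : ℕ) = 0 ∨ ∃ j, 1 ≤ j ∧ j < c.length ∧ (i : ℕ) = c.sizeUpTo j}
  | top c _ => {i | (i : ℕ) = 0 ∨ ∃ j, 1 ≤ j ∧ j < c.length ∧ (i : ℕ) = c.sizeUpTo j}
  | dual c _ => {i | (i : ℕ) = 1 ∨ ∃ j, 1 ≤ j ∧ j < c.length ∧ (i : ℕ) = c.sizeUpTo j}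

/-- The relation `κ ≈ ν`. -/
def Equivalent {n : ℕ} (κ ν : DComposition n) : Prop :=
  κ.components.Perm ν.components ∧
    ¬ (κ.IsTop ∧ ν.IsDual ∧ ∀ a ∈ κ.components, Even a) ∧
    ¬ (κ.IsDual ∧ ν.IsTop ∧ ∀ a ∈ κ.components, Even a)

/-- `κ` has a component of multiplicity `p` or more. -/
def HasMultiplicityAtLeast {n : ℕ} (p : ℕ) (κ : DComposition n) : Prop :=
  ∃ a ∈ κ.components, p ≤ κ.components.count a

/-- The empty composition `[ ]`. -/
def empty {n : ℕ} (hn : 2 ≤ n) : DComposition n :=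
  below 0 (by omega) (Composition.ones 0)

/-- The composition `[n]`. -/
def single {n : ℕ} (hn : 2 ≤ n) : DComposition n :=
  top (Composition.single n (by omega)) ⟨n, by simp, hn⟩

/-- The composition `[n]^∨`. -/
def singleDual {n : ℕ} (hn : 2 ≤ n) : DComposition n :=
  dual (Composition.single n (by omega)) ⟨n, by simp, hn⟩

end DComposition

/-- `B_κ`, the sum `𝒳_{J^c}` for the subset `J` that corresponds to `κ`. -/
noncomputable def B {n : ℕ} (κ : DComposition n) : descentRing n :=
  ⟨repSum κ.subsetᶜ, Subring.subset_closure ⟨κ.subsetᶜ, rfl⟩⟩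

/-- The image of `B_κ` in `Σ(D_n, p)`. -/
noncomputable def Bbar {n : ℕ} (p : ℕ) (κ : DComposition n) : ModularDescentAlgebra n p :=
  Ideal.Quotient.mk (multiples n p) (B κ)

/-- The radical of `Σ(D_n, p)`, that is, its Jacobson radical. -/
noncomputable def radical (n p : ℕ) : Ideal (ModularDescentAlgebra n p) :=
  Ring.jacobson (ModularDescentAlgebra n p)

end TypeD

open TypeD

/-!
Let `D_n` act on odd vectors. The elements of minimal length in the cosets of `W_J` correspond to
the members of the orbit of a face vector `v` of `J`, and sorting the orbit by its descents gives
Solomon's formula: `𝒳_K * 𝒳_J` is the sum, over the `u` in the orbit of a face vector of `K` that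
are weakly increasing along `J`, of `𝒳_L` with `L = {i ∈ J | u (lo i) = u (hi i)}`. So the `𝒳_J`
form a `ℤ`-basis of the descent ring, whose left multiplications are triangular for inclusion; the
diagonal entry of `𝒳_K` at `J` counts the members `u` of the orbit that are constant along `J`.

Reduced modulo `p`, the diagonal entries are characters with values in `𝔽_p`, and an element that
all of them annihilate is nilpotent, so the radical is their common kernel. The diagonal entry of
`B_κ` at `ν` counts the `u` in the orbit of the vector of `κ` that are functions of the vector of
`ν`. Equivalent `κ` have the same counts. If `p` components of `κ` agree, permuting their values is
an action of a cyclic group of order `p` without fixed points on the set that is counted, and sign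
changes of the values do the same for `p = 2`.

Conversely, if the entry of `B_κ` at `ν` is not zero and `κ` has at least as many components as `ν`,
then `κ ≈ ν`. The entry of `B_ν` at `ν` is the order of a group of permutations of the values of the
vector of `ν`, so if an odd `p` divides it, then by Cauchy's theorem some component of `ν` occurs at
least `p` times. For odd `p`, a shortest `ν` in the support of a radical element in which no given
generator can be split off would therefore yield a nonzero character value; for `p = 2` the
characters at `[ ]` and `[n]` suffice.
-/

namespace TypeD

section SignedPoints

variable {n : ℕ}

instance (n : ℕ) : InvolutiveNeg (SignedPoint n) where
  neg a := ⟨-a.1, by have := a.2; omega⟩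
  neg_neg a := Subtype.ext (neg_neg a.1)

noncomputable instance (n : ℕ) : Fintype (SignedPoint n) := Fintype.ofFinite _

noncomputable instance (n : ℕ) : Fintype (coxeterGroup n) := Fintype.ofFinite _

@[simp]
theorem coe_neg (a : SignedPoint n) : ((-a : SignedPoint n) : ℤ) = -(a : ℤ) := rfl

theorem odd_coe : Function.Odd ((↑) : SignedPoint n → ℤ) := coe_neg

theorem eq_or_eq_neg_of_abs_eq {a b : SignedPoint n} (h : |(a : ℤ)| = |(b : ℤ)|) :
    a = b ∨ a = -b :=
  (abs_eq_abs.mp h).imp (Subtype.ext ·) (Subtype.ext ·)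

theorem odd_funext {α : Type*} [Neg α] {u v : SignedPoint n → α} (hu : u.Odd) (hv : v.Odd)
    (h : ∀ a : SignedPoint n, 0 < (a : ℤ) → u a = v a) : u = v := by
  funext a
  rcases lt_or_gt_of_ne a.2.1 with ha | ha
  · rw [← neg_neg a, hu (-a), hv (-a), h (-a) (by simpa using ha)]
  · exact h a ha

/-- The set `{1, …, n}` of positive points. -/
noncomputable def positives (n : ℕ) : Finset (SignedPoint n) := {a | 0 < (a : ℤ)}

@[simp]
theorem mem_positives {a : SignedPoint n} : a ∈ positives n ↔ 0 < (a : ℤ) := by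
  simp [positives]

theorem prod_positives_comp_perm {M : Type*} [CommMonoid M] {f : SignedPoint n → M} (hf : f.Even)
    {w : Equiv.Perm (SignedPoint n)} (hw : Function.Odd w) :
    ∏ a ∈ positives n, f (w a) = ∏ a ∈ positives n, f a := by
  let i (a : SignedPoint n) : SignedPoint n := if 0 < (w a : ℤ) then w a else -w a
  have hi : Set.MapsTo i (positives n) (positives n) := fun a _ => by
    have := (w a).2
    simp only [i, Finset.mem_coe, mem_positives]
    split_ifs with h
    · exact h
    · rw [coe_neg]
      omega
  have hinj : Set.InjOn i (positives n) := by
    intro a ha b hb hab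
    rw [Finset.mem_coe, mem_positives] at ha hb
    have habs : w a = w b ∨ w a = w (-b) := by
      rw [hw]
      grind [neg_neg]
    rcases habs with h | h
    · exact w.injective h
    · have := congrArg Subtype.val (w.injective h)
      rw [coe_neg] at this
      omega
  refine Finset.prod_nbij i hi hinj (Finset.surjOn_of_injOn_of_card_le i hi hinj le_rfl) ?_
  intro a _
  simp only [i]
  split_ifs
  · rfl
  · exact (hf _).symm

/-- The pairs `a < b` of points that are not antipodal. Each positive root of `D_n` gives two of
them, `(a, b)` and `(-b, -a)`. -/
noncomputable def rootPairs (n : ℕ) : Finset (SignedPoint n × SignedPoint n) :=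
  {e | e.1 < e.2 ∧ e.2 ≠ -e.1}

theorem mem_rootPairs {e : SignedPoint n × SignedPoint n} :
    e ∈ rootPairs n ↔ e.1 < e.2 ∧ e.2 ≠ -e.1 := by
  simp [rootPairs]

end SignedPoints

section SimpleReflections

variable {n : ℕ} [hn : Fact (2 ≤ n)]

/-- The lower member of the pair `lo i < hi i` of points that the `i`-th simple reflection
interchanges; the other pair that it interchanges is `-hi i < -lo i`. -/
def lo (i : Fin n) : SignedPoint n :=
  ⟨if (i : ℕ) = 0 then -1 else (i : ℤ), by have := hn.out; have := i.2; split_ifs <;> omega⟩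

/-- The upper member of the pair `lo i < hi i` of points that the `i`-th simple reflection
interchanges. -/
def hi (i : Fin n) : SignedPoint n :=
  ⟨if (i : ℕ) = 0 then 2 else (i : ℤ) + 1, by have := hn.out; have := i.2; split_ifs <;> omega⟩

theorem coe_lo (i : Fin n) : (lo i : ℤ) = if (i : ℕ) = 0 then -1 else (i : ℤ) := rfl

theorem coe_hi (i : Fin n) : (hi i : ℤ) = if (i : ℕ) = 0 then 2 else (i : ℤ) + 1 := rfl

theorem lo_lt_hi (i : Fin n) : lo i < hi i := by
  rw [← Subtype.coe_lt_coe, coe_lo, coe_hi]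
  split_ifs <;> omega

theorem neg_hi_lt_neg_lo (i : Fin n) : -hi i < -lo i :=
  Int.neg_lt_neg (lo_lt_hi i)

theorem hi_ne_neg_lo (i : Fin n) : hi i ≠ -lo i := by
  rw [Ne, Subtype.ext_iff, coe_neg, coe_lo, coe_hi]
  split_ifs <;> omega

theorem simpleReflection_eq (i : Fin n) :
    simpleReflection n i = Equiv.swap (-hi i) (-lo i) * Equiv.swap (lo i) (hi i) := by
  have h2 := hn.out
  unfold simpleReflection
  split_ifs with h
  · rw [Equiv.swap_comm (-hi i), show lo i = ⟨-1, by omega⟩ from Subtype.ext (by simp [coe_lo, h]),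
      show hi i = ⟨2, by omega⟩ from Subtype.ext (by simp [coe_hi, h]), Equiv.swap_comm]
    rfl
  · congr 2 <;> ext <;> simp [coe_lo, coe_hi, h]
    ring

theorem coe_simpleReflection_apply (i : Fin n) (a : SignedPoint n) :
    (simpleReflection n i a : ℤ) =
      if (a : ℤ) = lo i then (hi i : ℤ) else if (a : ℤ) = hi i then (lo i : ℤ)
      else if (a : ℤ) = -lo i then -(hi i : ℤ) else if (a : ℤ) = -hi i then -(lo i : ℤ)
      else (a : ℤ) := by
  have hlo := coe_lo i
  have hhi := coe_hi i
  have := a.2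
  rw [simpleReflection_eq, Equiv.Perm.mul_apply, Equiv.swap_apply_def, Equiv.swap_apply_def]
  simp only [Subtype.ext_iff, apply_ite (fun x : SignedPoint n => (x : ℤ)), coe_neg]
  split_ifs at * <;> omega

theorem simpleReflection_lo (i : Fin n) : simpleReflection n i (lo i) = hi i :=
  Subtype.ext (by rw [coe_simpleReflection_apply, if_pos rfl])

theorem simpleReflection_hi (i : Fin n) : simpleReflection n i (hi i) = lo i :=
  Subtype.ext (by
    rw [coe_simpleReflection_apply, if_neg (Subtype.coe_lt_coe.mpr (lo_lt_hi i)).ne', if_pos rfl])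

theorem odd_simpleReflection (i : Fin n) : Function.Odd (simpleReflection n i) := by
  intro a
  have hlo := coe_lo i
  have hhi := coe_hi i
  have := a.2
  rw [Subtype.ext_iff, coe_neg, coe_simpleReflection_apply, coe_simpleReflection_apply, coe_neg]
  split_ifs at * <;> omega

theorem simpleReflection_simpleReflection (i : Fin n) (a : SignedPoint n) :
    simpleReflection n i (simpleReflection n i a) = a := by
  have hlo := coe_lo i
  have hhi := coe_hi i
  have := a.2
  have := coe_simpleReflection_apply i a
  rw [Subtype.ext_iff, coe_simpleReflection_apply i (simpleReflection n i a)]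
  split_ifs at * <;> omega

theorem simpleReflection_lt (i : Fin n) {a b : SignedPoint n} (hab : a < b) (hne : b ≠ -a)
    (hlohi : (a, b) ≠ (lo i, hi i)) (hneg : (a, b) ≠ (-hi i, -lo i)) :
    simpleReflection n i a < simpleReflection n i b := by
  have hlo := coe_lo i
  have hhi := coe_hi i
  have := a.2
  have := b.2
  rw [← Subtype.coe_lt_coe] at hab ⊢
  rw [coe_simpleReflection_apply, coe_simpleReflection_apply]
  simp only [Ne, Prod.ext_iff, Subtype.ext_iff, coe_neg] at hlohi hneg hne
  split_ifs at * <;> omega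

theorem lo_hi_or_exists_between {a b : SignedPoint n} (hab : a < b) (hne : b ≠ -a) :
    (∃ i, a = lo i ∧ b = hi i) ∨ (∃ i, a = -hi i ∧ b = -lo i) ∨
      ∃ c, (a < c ∧ c ≠ -a) ∧ c < b ∧ b ≠ -c := by
  have := hn.out
  have := a.2
  have := b.2
  simp only [← Subtype.coe_lt_coe, Ne, Subtype.ext_iff, coe_neg, coe_lo, coe_hi] at hab hne ⊢
  by_cases hpos : 0 < (a : ℤ) ∧ (b : ℤ) = a + 1
  · exact Or.inl ⟨⟨(a : ℤ).toNat, by omega⟩, by grind⟩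
  by_cases hneg : (b : ℤ) < 0 ∧ (b : ℤ) = a + 1
  · exact Or.inr (Or.inl ⟨⟨(-b : ℤ).toNat, by omega⟩, by grind⟩)
  by_cases hzero : (a : ℤ) = -1 ∧ (b : ℤ) = 2
  · exact Or.inl ⟨⟨0, by omega⟩, by grind⟩
  by_cases hzero' : (a : ℤ) = -2 ∧ (b : ℤ) = 1
  · exact Or.inr (Or.inl ⟨⟨0, by omega⟩, by grind⟩)
  refine Or.inr (Or.inr ?_)
  by_cases hsame : 0 < (a : ℤ) ∨ (b : ℤ) < 0
  · exact ⟨⟨a + 1, by omega⟩, by grind⟩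
  rcases lt_or_ge (-(a : ℤ)) b with h | h
  · exact if ha : (a : ℤ) = -1 then ⟨⟨2, by omega⟩, by grind⟩ else ⟨⟨-1, by omega⟩, by grind⟩
  · exact if hb : (b : ℤ) = 1 then ⟨⟨-2, by omega⟩, by grind⟩ else ⟨⟨1, by omega⟩, by grind⟩

theorem rel_of_rel_lo_hi {r : SignedPoint n → SignedPoint n → Prop} [IsTrans (SignedPoint n) r]
    (h : ∀ i, r (lo i) (hi i)) (hneg : ∀ i, r (-hi i) (-lo i)) {a b : SignedPoint n} (hab : a < b)
    (hne : b ≠ -a) : r a b := by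
  rcases lo_hi_or_exists_between hab hne with ⟨i, rfl, rfl⟩ | ⟨i, rfl, rfl⟩ | ⟨c, hac, hcb⟩
  · exact h i
  · exact hneg i
  · have := Subtype.coe_lt_coe.mpr hac.1
    have := Subtype.coe_lt_coe.mpr hcb.1
    exact _root_.trans (rel_of_rel_lo_hi h hneg hac.1 hac.2) (rel_of_rel_lo_hi h hneg hcb.1 hcb.2)
termination_by ((b : ℤ) - a).toNat
decreasing_by all_goals omega

end SimpleReflections

section Vectors

variable {n : ℕ}

/-- The number of root pairs whose order a vector reverses. Here and below a vector of `ℤ ^ n` is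
encoded as an odd function on the signed points, on which permutations act by composition. -/
noncomputable def invCount (v : SignedPoint n → ℤ) : ℕ :=
  ((rootPairs n).filter fun e => v e.2 < v e.1).card

/-- The vector `(w 1, …, w n)` of a signed permutation `w`. -/
def permVector (w : Equiv.Perm (SignedPoint n)) : SignedPoint n → ℤ := (↑) ∘ w

theorem odd_permVector {w : Equiv.Perm (SignedPoint n)} (hw : Function.Odd w) :
    (permVector w).Odd :=
  odd_coe.comp_odd hw

/-- The product of the signs of the coordinates of a vector. -/
noncomputable def posSign (v : SignedPoint n → ℤ) : ℤ := ∏ a ∈ positives n, (v a).sign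

theorem posSign_permVector_one : posSign (permVector (1 : Equiv.Perm (SignedPoint n))) = 1 :=
  Finset.prod_eq_one fun _ ha => Int.sign_eq_one_of_pos (mem_positives.mp ha)

theorem posSign_comp {v : SignedPoint n → ℤ} (hv : v.Odd) {w : Equiv.Perm (SignedPoint n)}
    (hw : Function.Odd w) : posSign (v ∘ w) = posSign (permVector w) * posSign v := by
  have heven : Function.Even fun a : SignedPoint n => (a : ℤ).sign * (v a).sign := fun a => by
    simp [hv a]
  calc posSign (v ∘ w)
      = ∏ a ∈ positives n, (w a : ℤ).sign * ((w a : ℤ).sign * (v (w a)).sign) :=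
        Finset.prod_congr rfl fun a _ => by
          have hsq : (w a : ℤ).sign * (w a : ℤ).sign = 1 := by
            rw [← Int.sign_mul, Int.sign_eq_one_of_pos (mul_self_pos.mpr (w a).2.1)]
          rw [← mul_assoc, hsq, one_mul, Function.comp_apply]
    _ = posSign (permVector w) * ∏ a ∈ positives n, (a : ℤ).sign * (v a).sign := by
        rw [Finset.prod_mul_distrib, prod_positives_comp_perm heven hw]
        rfl
    _ = posSign (permVector w) * posSign v := by
        congr 1
        refine Finset.prod_congr rfl fun a ha => ?_
        rw [Int.sign_eq_one_of_pos (mem_positives.mp ha), one_mul]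

end Vectors

section SimpleReflections

variable {n : ℕ} [hn : Fact (2 ≤ n)]

theorem pair_subset_rootPairs (i : Fin n) :
    {(lo i, hi i), (-hi i, -lo i)} ⊆ rootPairs n := by
  intro e he
  rw [Finset.mem_insert, Finset.mem_singleton] at he
  rw [mem_rootPairs]
  rcases he with rfl | rfl
  · exact ⟨lo_lt_hi i, hi_ne_neg_lo i⟩
  · exact ⟨neg_hi_lt_neg_lo i, fun h => hi_ne_neg_lo i (by simpa using h.symm)⟩

theorem simpleReflection_mem_rootPairs_sdiff (i : Fin n) {e : SignedPoint n × SignedPoint n}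
    (he : e ∈ rootPairs n \ {(lo i, hi i), (-hi i, -lo i)}) :
    (simpleReflection n i e.1, simpleReflection n i e.2) ∈
      rootPairs n \ {(lo i, hi i), (-hi i, -lo i)} := by
  obtain ⟨a, b⟩ := e
  simp only [Finset.mem_sdiff, mem_rootPairs, Finset.mem_insert, Finset.mem_singleton, not_or]
    at he ⊢
  obtain ⟨⟨hab, hne⟩, hlohi, hneg⟩ := he
  have hinj := (simpleReflection n i).injective
  refine ⟨⟨simpleReflection_lt i hab hne hlohi hneg, fun h => hne (hinj ?_)⟩, fun h => ?_,
    fun h => ?_⟩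
  · rw [h, odd_simpleReflection i a]
  · have ha : a = hi i := hinj (by rw [(Prod.mk.inj h).1, simpleReflection_hi])
    have hb : b = lo i := hinj (by rw [(Prod.mk.inj h).2, simpleReflection_lo])
    exact (ha ▸ hb ▸ hab).not_gt (lo_lt_hi i)
  · have ha : a = -lo i := hinj (by
      rw [(Prod.mk.inj h).1, odd_simpleReflection i, simpleReflection_lo])
    have hb : b = -hi i := hinj (by
      rw [(Prod.mk.inj h).2, odd_simpleReflection i, simpleReflection_hi])
    exact (ha ▸ hb ▸ hab).not_gt (neg_hi_lt_neg_lo i)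

theorem invCount_comp_simpleReflection {v : SignedPoint n → ℤ} (hv : v.Odd) (i : Fin n) :
    invCount (v ∘ simpleReflection n i) + (if v (hi i) < v (lo i) then 2 else 0) =
      invCount v + (if v (lo i) < v (hi i) then 2 else 0) := by
  set S := rootPairs n \ {(lo i, hi i), (-hi i, -lo i)}
  have hne : (lo i, hi i) ≠ (-hi i, -lo i) := fun h => hi_ne_neg_lo i (Prod.ext_iff.mp h).2
  have hsplit (u : SignedPoint n → ℤ) : invCount u =
      (∑ e ∈ S, if u e.2 < u e.1 then 1 else 0) +
        ((if u (hi i) < u (lo i) then 1 else 0) + (if u (-lo i) < u (-hi i) then 1 else 0)) := by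
    rw [invCount, Finset.card_filter, ← Finset.sum_sdiff (pair_subset_rootPairs i),
      Finset.sum_pair hne]
  have hS_comp : (∑ e ∈ S, if (v ∘ simpleReflection n i) e.2 < (v ∘ simpleReflection n i) e.1
      then 1 else 0) = ∑ e ∈ S, if v e.2 < v e.1 then 1 else 0 :=
    Finset.sum_nbij' (fun e => (simpleReflection n i e.1, simpleReflection n i e.2))
      (fun e => (simpleReflection n i e.1, simpleReflection n i e.2))
      (fun _ => simpleReflection_mem_rootPairs_sdiff i)
      (fun _ => simpleReflection_mem_rootPairs_sdiff i)
      (fun _ _ => by simp [simpleReflection_simpleReflection])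
      (fun _ _ => by simp [simpleReflection_simpleReflection]) fun _ _ => rfl
  rw [hsplit v, hsplit, hS_comp]
  simp only [Function.comp, odd_simpleReflection i _, simpleReflection_lo, simpleReflection_hi,
    hv _]
  split_ifs <;> omega

theorem posSign_simpleReflection (i : Fin n) : posSign (permVector (simpleReflection n i)) = 1 := by
  have h2 := hn.out
  by_cases h0 : (i : ℕ) = 0
  · have hsign (a : SignedPoint n) (ha : a ∈ positives n) :
        (simpleReflection n i a : ℤ).sign = if (a : ℤ) ≤ 2 then -1 else 1 := by
      rw [mem_positives] at ha
      rw [coe_simpleReflection_apply, coe_lo, coe_hi]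
      grind [Int.sign_eq_one_iff_pos, Int.sign_eq_neg_one_iff_neg]
    have hfilter : (positives n).filter (fun a : SignedPoint n => (a : ℤ) ≤ 2) =
        {(⟨1, by omega⟩ : SignedPoint n), (⟨2, by omega⟩ : SignedPoint n)} := by
      ext a
      simp only [Finset.mem_filter, mem_positives, Finset.mem_insert, Finset.mem_singleton,
        Subtype.ext_iff]
      omega
    calc posSign (permVector (simpleReflection n i))
        = ∏ a ∈ positives n, if (a : ℤ) ≤ 2 then -1 else 1 := Finset.prod_congr rfl hsign
      _ = 1 := by
        rw [Finset.prod_ite, hfilter, Finset.prod_const, Finset.prod_const_one,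
          Finset.card_pair (by simp [Subtype.ext_iff])]
        norm_num
  · refine Finset.prod_eq_one fun a ha => Int.sign_eq_one_of_pos ?_
    rw [mem_positives] at ha
    change 0 < (simpleReflection n i a : ℤ)
    rw [coe_simpleReflection_apply, coe_lo, coe_hi, if_neg h0, if_neg h0]
    split_ifs <;> omega

end SimpleReflections

section CoxeterGroup

variable {n : ℕ} [hn : Fact (2 ≤ n)]

theorem gen_mul_gen (i : Fin n) : gen n i * gen n i = 1 :=
  Subtype.ext (Equiv.ext fun a => simpleReflection_simpleReflection i a)

theorem coxeter_induction {q : coxeterGroup n → Prop} (one : q 1)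
    (mul_gen : ∀ w i, q w → q (w * gen n i)) (w : coxeterGroup n) : q w := by
  have hgen (i : Fin n) : (simpleReflection n i)⁻¹ = simpleReflection n i :=
    inv_eq_of_mul_eq_one_left (congrArg Subtype.val (gen_mul_gen i))
  obtain ⟨w, hw⟩ := w
  induction hw using Subgroup.closure_induction_right with
  | one => exact one
  | mul_right w hw s hs ih =>
    obtain ⟨i, rfl⟩ := hs
    exact mul_gen ⟨w, hw⟩ i ih
  | mul_inv_cancel w hw s hs ih =>
    obtain ⟨i, rfl⟩ := hs
    simp only [hgen]
    exact mul_gen ⟨w, hw⟩ i ih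

theorem odd_coxeter (w : coxeterGroup n) : Function.Odd w.1 := by
  induction w using coxeter_induction with
  | one => exact fun _ => rfl
  | mul_gen w i ih => exact ih.comp_odd (odd_simpleReflection i)

theorem posSign_coxeter (w : coxeterGroup n) : posSign (permVector w.1) = 1 := by
  induction w using coxeter_induction with
  | one => exact posSign_permVector_one
  | mul_gen w i ih =>
    change posSign (permVector w.1 ∘ simpleReflection n i) = 1
    rw [posSign_comp (odd_permVector (odd_coxeter w)) (odd_simpleReflection i),
      posSign_simpleReflection, ih, one_mul]

theorem posSign_comp_coxeter {v : SignedPoint n → ℤ} (hv : v.Odd) (w : coxeterGroup n) :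
    posSign (v ∘ w.1) = posSign v := by
  rw [posSign_comp hv (odd_coxeter w), posSign_coxeter, one_mul]

end CoxeterGroup

section MonotoneRearrangement

variable {α β γ : Type*} [Finite α] [LinearOrder β] [LinearOrder γ] {h : α → β} {f : α → γ}
  {π : Equiv.Perm α}

theorem apply_perm_le_of_monotone (hf : ∀ a b, h a ≤ h b → f a ≤ f b)
    (hfπ : ∀ a b, h a ≤ h b → f (π a) ≤ f (π b)) (a : α) : f (π a) ≤ f a := by
  have := Fintype.ofFinite α
  by_contra! hlt
  have hssub : (Finset.univ.filter fun b => f (π a) ≤ f b) ⊂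
      Finset.univ.filter fun b => f (π a) ≤ f (π b) := by
    refine (Finset.ssubset_iff_of_subset fun b hb => ?_).mpr ⟨a, by simp, by simpa using hlt⟩
    rw [Finset.mem_filter_univ] at hb ⊢
    exact hfπ a b (le_of_not_ge fun hba => (hf b a hba).not_gt (hlt.trans_le hb))
  exact (Finset.card_lt_card hssub).ne (Finset.card_equiv π (by simp)).symm

theorem comp_perm_eq_of_monotone (hf : ∀ a b, h a ≤ h b → f a ≤ f b)
    (hfπ : ∀ a b, h a ≤ h b → f (π a) ≤ f (π b)) : f ∘ π = f :=
  funext fun a => le_antisymm (apply_perm_le_of_monotone hf hfπ a) <| by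
    simpa using apply_perm_le_of_monotone (f := f ∘ π) (π := π⁻¹) hfπ (by simpa using hf) a

end MonotoneRearrangement

section Dominant

variable {n : ℕ} [hn : Fact (2 ≤ n)] {u v : SignedPoint n → ℤ}

/-- A vector in the closed fundamental chamber. -/
def IsDominant (v : SignedPoint n → ℤ) : Prop := ∀ i, v (lo i) ≤ v (hi i)

theorem IsDominant.le (dv : IsDominant v) (hv : v.Odd) {a b : SignedPoint n} (hab : a < b)
    (hne : b ≠ -a) : v a ≤ v b :=
  have : IsTrans (SignedPoint n) fun x y => v x ≤ v y := ⟨fun _ _ _ => le_trans⟩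
  rel_of_rel_lo_hi (r := fun x y => v x ≤ v y) dv
    (fun i => by rw [hv, hv]; exact neg_le_neg (dv i)) hab hne

theorem IsDominant.abs_le (dv : IsDominant v) (hv : v.Odd) {a b : SignedPoint n}
    (hab : |(a : ℤ)| < b) : |v a| ≤ v b := by
  obtain ⟨h, hneg⟩ := abs_lt.mp hab
  rw [abs_le', ← hv]
  refine ⟨dv.le hv hneg fun h' => ?_, dv.le hv (neg_lt.mp h) fun h' => ?_⟩ <;>
  · have := congrArg Subtype.val h'
    simp only [coe_neg] at this
    omega

theorem IsDominant.abs_le_abs (dv : IsDominant v) (hv : v.Odd) {a b : SignedPoint n}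
    (hab : |(a : ℤ)| ≤ |(b : ℤ)|) : |v a| ≤ |v b| := by
  rcases hab.eq_or_lt with h | h
  · rcases eq_or_eq_neg_of_abs_eq h with rfl | rfl
    · exact le_rfl
    · rw [hv, abs_neg]
  · rcases lt_abs.mp h with h | h
    · exact (dv.abs_le hv h).trans (le_abs_self _)
    · have := dv.abs_le hv (b := -b) h
      exact this.trans (hv b ▸ neg_le_abs _)

theorem IsDominant.posSign_eq_sign (dv : IsDominant v) (hv : v.Odd) {a : SignedPoint n}
    (ha : (a : ℤ) = 1) (h0 : v a ≠ 0) : posSign v = (v a).sign := by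
  refine Finset.prod_eq_single a (fun b hb hba => ?_) fun h => ?_
  · have hb1 : (b : ℤ) ≠ 1 := fun h => hba (Subtype.ext (h.trans ha.symm))
    rw [mem_positives] at hb
    exact Int.sign_eq_one_of_pos <| (abs_pos.mpr h0).trans_le (dv.abs_le hv (by grind))
  · simp [ha] at h

theorem IsDominant.nonneg (dv : IsDominant v) (hv : v.Odd) {a : SignedPoint n}
    (ha : 1 < (a : ℤ)) : 0 ≤ v a :=
  (abs_nonneg _).trans (dv.abs_le hv (a := ⟨1, by have := a.2; omega⟩) (by simpa using ha))

theorem IsDominant.eq_of_comp_perm (du : IsDominant u) (hu : u.Odd) (dv : IsDominant v)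
    (hv : v.Odd) {π : Equiv.Perm (SignedPoint n)} (hπ : u = v ∘ π)
    (hs : posSign u = posSign v) : u = v := by
  have habs (a : SignedPoint n) : |u a| = |v a| := by
    rw [hπ]
    exact congrFun (comp_perm_eq_of_monotone (h := fun a : SignedPoint n => |(a : ℤ)|)
      (f := fun a => |v a|) (fun _ _ => dv.abs_le_abs hv)
      fun a b hab => by simpa [hπ] using du.abs_le_abs hu hab) a
  refine odd_funext hu hv fun a ha => ?_
  by_cases h1 : (a : ℤ) = 1
  · by_cases hu0 : u a = 0
    · rw [hu0, eq_comm, ← abs_eq_zero, ← habs, hu0, abs_zero]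
    · have hv0 : v a ≠ 0 := by rwa [← abs_ne_zero, ← habs, abs_ne_zero]
      rw [du.posSign_eq_sign hu h1 hu0, dv.posSign_eq_sign hv h1 hv0] at hs
      rw [← Int.sign_mul_abs (u a), ← Int.sign_mul_abs (v a), hs, habs]
  · have h1' : 1 < (a : ℤ) := by omega
    rw [← abs_of_nonneg (du.nonneg hu h1'), ← abs_of_nonneg (dv.nonneg hv h1'), habs]

theorem exists_isDominant_comp (hv : v.Odd) : ∃ w : coxeterGroup n, IsDominant (v ∘ w.1) := by
  obtain ⟨w, hw⟩ := Finite.exists_min fun w : coxeterGroup n => invCount (v ∘ w.1)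
  refine ⟨w, fun i => ?_⟩
  by_contra! h
  have hcomp := invCount_comp_simpleReflection (hv.comp_odd (odd_coxeter w)) i
  have hmin : invCount (v ∘ w.1) ≤ invCount ((v ∘ w.1) ∘ simpleReflection n i) := hw (w * gen n i)
  rw [if_pos h, if_neg h.not_gt] at hcomp
  omega

end Dominant

section Orbits

variable {n : ℕ} [hn : Fact (2 ≤ n)] {u v : SignedPoint n → ℤ}

/-- The orbit of a vector under `D_n`. -/
noncomputable def orbit (v : SignedPoint n → ℤ) : Finset (SignedPoint n → ℤ) :=
  open Classical in Finset.univ.image fun w : coxeterGroup n => v ∘ w.1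

omit hn in
theorem mem_orbit : u ∈ orbit v ↔ ∃ w : coxeterGroup n, v ∘ w.1 = u := by
  simp [orbit]

theorem mem_orbit_iff (hv : v.Odd) :
    u ∈ orbit v ↔
      u.Odd ∧ (∃ π : Equiv.Perm (SignedPoint n), u = v ∘ π) ∧ posSign u = posSign v := by
  rw [mem_orbit]
  constructor
  · rintro ⟨w, rfl⟩
    exact ⟨hv.comp_odd (odd_coxeter w), ⟨w.1, rfl⟩, posSign_comp_coxeter hv w⟩
  · rintro ⟨hu, ⟨π, hπ⟩, hs⟩
    obtain ⟨x, dx⟩ := exists_isDominant_comp hv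
    obtain ⟨y, dy⟩ := exists_isDominant_comp hu
    have huv : u ∘ y.1 = v ∘ x.1 :=
      dy.eq_of_comp_perm (hu.comp_odd (odd_coxeter y)) dx (hv.comp_odd (odd_coxeter x))
        (π := x.1⁻¹ * π * y.1) (by rw [hπ]; funext a; simp)
        (by rw [posSign_comp_coxeter hu, posSign_comp_coxeter hv, hs])
    refine ⟨x * y⁻¹, funext fun a => ?_⟩
    simpa using (congrFun huv (y.1.symm a)).symm

end Orbits

section Length

variable {n : ℕ} [hn : Fact (2 ≤ n)]

theorem eq_one_of_lo_lt_hi {w : coxeterGroup n} (h : ∀ i, w.1 (lo i) < w.1 (hi i)) : w = 1 := by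
  have hone : permVector w.1 = permVector (1 : coxeterGroup n).1 :=
    IsDominant.eq_of_comp_perm (π := w.1) (fun i => (h i).le) (odd_permVector (odd_coxeter w))
      (fun i => (lo_lt_hi i).le) (odd_permVector (odd_coxeter 1)) rfl
      (by rw [posSign_coxeter, posSign_coxeter])
  exact Subtype.ext (Equiv.ext fun a => Subtype.ext (congrFun hone a))

omit hn in
theorem invCount_permVector_one : invCount (permVector (1 : coxeterGroup n).1) = 0 := by
  rw [invCount, Finset.card_eq_zero, Finset.filter_eq_empty_iff]
  exact fun e he => not_lt.mpr (mem_rootPairs.mp he).1.le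

theorem invCount_mul_gen (w : coxeterGroup n) (i : Fin n) :
    invCount (permVector (w * gen n i).1) + (if w.1 (hi i) < w.1 (lo i) then 2 else 0) =
      invCount (permVector w.1) + (if w.1 (lo i) < w.1 (hi i) then 2 else 0) :=
  invCount_comp_simpleReflection (odd_permVector (odd_coxeter w)) i

theorem exists_word_two_mul_length (w : coxeterGroup n) :
    ∃ l : List (Fin n), (l.map (gen n)).prod = w ∧ 2 * l.length = invCount (permVector w.1) := by
  induction h : invCount (permVector w.1) using Nat.strong_induction_on generalizing w with
  | _ k ih =>
    subst h
    by_cases hw : ∀ i, w.1 (lo i) < w.1 (hi i)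
    · rw [eq_one_of_lo_lt_hi hw]
      exact ⟨[], rfl, invCount_permVector_one.symm⟩
    · push Not at hw
      obtain ⟨i, hle⟩ := hw
      have hlt := hle.lt_of_ne fun h => (lo_lt_hi i).ne' (w.1.injective h)
      have hmul := invCount_mul_gen w i
      rw [if_pos hlt, if_neg hle.not_gt] at hmul
      obtain ⟨l, hl, hlen⟩ := ih _ (by omega) (w * gen n i) rfl
      refine ⟨l ++ [i], ?_, ?_⟩
      · simp [hl, mul_assoc, gen_mul_gen]
      · rw [List.length_append, List.length_singleton]
        omega

theorem invCount_prod_le (l : List (Fin n)) :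
    invCount (permVector (l.map (gen n)).prod.1) ≤ 2 * l.length := by
  induction l using List.reverseRecOn with
  | nil => exact invCount_permVector_one.le
  | append_singleton l i ih =>
    have hmul := invCount_mul_gen (l.map (gen n)).prod i
    simp only [List.map_append, List.prod_append, List.map_cons, List.map_nil, List.prod_singleton,
      List.length_append, List.length_singleton]
    split_ifs at hmul <;> omega

theorem two_mul_length (w : coxeterGroup n) : 2 * length w = invCount (permVector w.1) := by
  obtain ⟨l, hl, hlen⟩ := exists_word_two_mul_length w
  have hle : length w ≤ l.length := Nat.sInf_le ⟨l, rfl, hl⟩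
  obtain ⟨m, hm, hprod⟩ :
      length w ∈ {k | ∃ l : List (Fin n), l.length = k ∧ (l.map (gen n)).prod = w} :=
    Nat.sInf_mem ⟨_, l, rfl, hl⟩
  have hge := invCount_prod_le m
  rw [hm, hprod] at hge
  omega

end Length

section Levels

variable {m : ℕ} (c : Composition m)

theorem sizeUpTo_lt_sizeUpTo {i j : ℕ} (hij : i < j) (hj : j ≤ c.length) :
    c.sizeUpTo i < c.sizeUpTo j :=
  (c.sizeUpTo_strict_mono (by omega)).trans_le (c.monotone_sizeUpTo hij)

theorem exists_sizeUpTo_iff (hm : 0 < m) (i : ℕ) :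
    (i = 0 ∨ ∃ j, 1 ≤ j ∧ j < c.length ∧ i = c.sizeUpTo j) ↔ ∃ j < c.length, c.sizeUpTo j = i := by
  constructor
  · rintro (rfl | ⟨j, -, hj, rfl⟩)
    · exact ⟨0, c.length_pos_of_pos hm, c.sizeUpTo_zero⟩
    · exact ⟨j, hj, rfl⟩
  · rintro ⟨j, hj, rfl⟩
    rcases Nat.eq_zero_or_pos j with rfl | hpos
    · exact Or.inl c.sizeUpTo_zero
    · exact Or.inr ⟨j, hpos, hj, rfl⟩

theorem exists_mem_head?_blocks_iff (hm : 0 < m) (q : ℕ → Prop) :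
    (∃ a ∈ c.blocks.head?, q a) ↔ q (c.sizeUpTo 1) := by
  have hsum := c.blocks_sum
  unfold Composition.sizeUpTo
  cases hb : c.blocks with
  | nil => rw [hb, List.sum_nil] at hsum; omega
  | cons a l => simp

/-- The index, counted from `1`, of the block of `c` that contains the position `x`, where the
first block of `c` begins after the position `k`; it is `0` for `x ≤ k`. -/
def level (k x : ℕ) : ℕ := ((Finset.range c.length).filter fun j => k + c.sizeUpTo j < x).card

theorem level_le (k x : ℕ) : level c k x ≤ c.length :=
  (Finset.card_filter_le _ _).trans (Finset.card_range _).le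

theorem lt_level_iff (k x : ℕ) {j : ℕ} (hj : j < c.length) :
    j < level c k x ↔ k + c.sizeUpTo j < x := by
  constructor
  · contrapose!
    intro hx
    refine (Finset.card_le_card fun i hi => ?_).trans (Finset.card_range j).le
    rw [Finset.mem_filter] at hi
    exact Finset.mem_range.mpr <| lt_of_not_ge fun hji =>
      absurd (c.monotone_sizeUpTo hji) (by omega)
  · intro hx
    refine (Finset.card_range (j + 1)).symm.trans_le (Finset.card_le_card fun i hi => ?_)
    have hij := Finset.mem_range_succ_iff.mp hi
    have := c.monotone_sizeUpTo hij
    exact Finset.mem_filter.mpr ⟨Finset.mem_range.mpr (by omega), by omega⟩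

theorem level_eq_succ_iff {k x : ℕ} (hx : x ≤ k + m) {j : ℕ} (hj : j < c.length) :
    level c k x = j + 1 ↔ k + c.sizeUpTo j < x ∧ x ≤ k + c.sizeUpTo (j + 1) := by
  rw [← lt_level_iff c k x hj]
  by_cases hj' : j + 1 < c.length
  · rw [← not_lt, ← lt_level_iff c k x hj']
    omega
  · have := level_le c k x
    rw [show j + 1 = c.length by omega, c.sizeUpTo_length]
    omega

theorem level_mono (k : ℕ) : Monotone (level c k) := fun _ _ hxy =>
  Finset.card_le_card (Finset.monotone_filter_right _ fun _ _ h => lt_of_lt_of_le h hxy)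

theorem level_eq_level_succ_iff (k i : ℕ) :
    level c k i = level c k (i + 1) ↔ ¬ ∃ j < c.length, k + c.sizeUpTo j = i := by
  constructor
  · rintro h ⟨j, hj, rfl⟩
    have := lt_level_iff c k (k + c.sizeUpTo j) hj
    have := lt_level_iff c k (k + c.sizeUpTo j + 1) hj
    omega
  · intro h
    refine congrArg Finset.card (Finset.filter_congr fun j hj => ?_)
    have : k + c.sizeUpTo j ≠ i := fun hi => h ⟨j, Finset.mem_range.mp hj, hi⟩
    omega

theorem level_eq_zero {k x : ℕ} (hx : x ≤ k) : level c k x = 0 := by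
  rw [level, Finset.card_eq_zero, Finset.filter_eq_empty_iff]
  intro j _
  omega

theorem level_pos (hm : 0 < m) {x : ℕ} (hx : 0 < x) : 0 < level c 0 x := by
  rwa [lt_level_iff c 0 x (c.length_pos_of_pos hm), c.sizeUpTo_zero]

theorem level_eq_one (hm : 0 < m) {x : ℕ} (hx : 0 < x) (hx1 : x ≤ c.sizeUpTo 1) :
    level c 0 x = 1 := by
  have := c.sizeUpTo_le 1
  rw [level_eq_succ_iff c (by omega) (c.length_pos_of_pos hm), c.sizeUpTo_zero, zero_add, zero_add]
  exact ⟨hx, hx1⟩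

theorem exists_composition (K : Set ℕ) (hK : 0 < m → 0 ∈ K) :
    ∃ c : Composition m, ∀ i < m, (∃ j < c.length, c.sizeUpTo j = i) ↔ i ∈ K := by
  classical
  let d : CompositionAsSet m :=
    { boundaries := Finset.univ.filter fun i => (i : ℕ) ∈ K ∨ i = Fin.last m
      zero_mem := by
        rw [Finset.mem_filter]
        refine ⟨Finset.mem_univ _, ?_⟩
        rcases Nat.eq_zero_or_pos m with rfl | hm
        · exact Or.inr rfl
        · exact Or.inl (hK hm)
      getLast_mem := by simp }
  refine ⟨d.toComposition, fun i hi => ?_⟩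
  have hboundary : (⟨i, by omega⟩ : Fin (m + 1)) ∈ d.toComposition.boundaries ↔ i ∈ K := by
    rw [d.toComposition_boundaries]
    simp only [d, Finset.mem_filter, Finset.mem_univ, true_and, Fin.ext_iff, Fin.val_last]
    exact or_iff_left hi.ne
  rw [← hboundary, Composition.boundaries, Finset.mem_map]
  constructor
  · rintro ⟨j, hj, hji⟩
    exact ⟨⟨j, by omega⟩, Finset.mem_univ _, Fin.ext hji⟩
  · rintro ⟨j, -, hji⟩
    replace hji : d.toComposition.sizeUpTo j = i := congrArg Fin.val hji
    refine ⟨j, lt_of_not_ge fun hj => ?_, hji⟩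
    rw [d.toComposition.sizeUpTo_ofLength_le _ hj] at hji
    omega

end Levels

section FaceVectors

variable {n : ℕ} [hn : Fact (2 ≤ n)]

/-- `v` is a dominant vector whose stabilizer is `W_J`: it is fixed by exactly those generators
whose index lies in `J`. -/
structure IsFaceVector (v : SignedPoint n → ℤ) (J : Set (Fin n)) : Prop where
  odd : v.Odd
  dominant : IsDominant v
  eq_iff : ∀ i, v (lo i) = v (hi i) ↔ i ∈ J

end FaceVectors

namespace DComposition

section Vector

variable {n : ℕ}

/-- The number of coordinates of the vector of `κ` that belong to no component. -/
def offset : DComposition n → ℕ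
  | below m _ _ => n - m
  | _ => 0

/-- The sum of the components. -/
def total : DComposition n → ℕ
  | below m _ _ => m
  | _ => n

/-- The underlying composition. -/
def composition : (κ : DComposition n) → Composition κ.total
  | below _ _ c => c
  | one c _ => c
  | top c _ => c
  | dual c _ => c

theorem offset_add_total (κ : DComposition n) : κ.offset + κ.total = n := by
  cases κ <;> simp only [offset, total] <;> omega

theorem blocks_composition (κ : DComposition n) : κ.composition.blocks = κ.components := by
  cases κ <;> rfl

open Classical in
/-- The face vector of `κ`. Its coordinates at `1, …, n` are `offset` zeros followed by `κ₁` ones,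
`κ₂` twos and so on; for `κ ∈ 𝒞_n'` the sign of the first coordinate is reversed. -/
noncomputable def vector (κ : DComposition n) (a : SignedPoint n) : ℤ :=
  (if κ.IsDual ∧ (a : ℤ).natAbs = 1 then -1 else 1) *
    ((a : ℤ).sign * level κ.composition κ.offset (a : ℤ).natAbs)

theorem odd_vector (κ : DComposition n) : κ.vector.Odd := fun a => by
  unfold vector
  split_ifs <;> simp_all

theorem natAbs_vector (κ : DComposition n) (a : SignedPoint n) :
    (κ.vector a).natAbs = level κ.composition κ.offset (a : ℤ).natAbs := by
  unfold vector
  rw [Int.natAbs_mul, Int.natAbs_mul, Int.natAbs_sign_of_ne_zero a.2.1]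
  split_ifs <;> simp

theorem vector_of_pos (κ : DComposition n) {a : SignedPoint n} (ha : 0 < (a : ℤ))
    (h : ¬ (κ.IsDual ∧ (a : ℤ) = 1)) :
    κ.vector a = level κ.composition κ.offset (a : ℤ).natAbs := by
  unfold vector
  rw [if_neg fun h' => h ⟨h'.1, by omega⟩, one_mul, Int.sign_eq_one_of_pos ha, one_mul]

theorem mem_subset_iff (κ : DComposition n) {i : Fin n} (hi : (i : ℕ) ≠ 0)
    (h : ¬ (κ.IsDual ∧ (i : ℕ) = 1)) :
    i ∈ κ.subset ↔ ∃ j < κ.composition.length, κ.offset + κ.composition.sizeUpTo j = i := by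
  have := i.2
  cases κ with
  | below m hm c => simp only [offset, composition, total, subset, Set.mem_ofPred_eq, eq_comm]
  | one c | top c =>
    simp only [offset, composition, total, subset, Set.mem_ofPred_eq, zero_add]
    exact exists_sizeUpTo_iff c (by omega) i
  | dual c =>
    simp only [offset, composition, total, subset, Set.mem_ofPred_eq, zero_add]
    rw [← exists_sizeUpTo_iff c (by omega)]
    simp_all [IsDual]

end Vector

section FaceVector

variable {n : ℕ} [hn : Fact (2 ≤ n)]

theorem two_le_sizeUpTo_one {c : Composition n} (h : ∃ a ∈ c.blocks.head?, 2 ≤ a) :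
    2 ≤ c.sizeUpTo 1 :=
  (exists_mem_head?_blocks_iff c (two_pos.trans_le hn.out) _).mp h

theorem zero_notMem_subset_dual {c : Composition n} (h : ∃ a ∈ c.blocks.head?, 2 ≤ a) {i : Fin n}
    (hi : (i : ℕ) = 0) : i ∉ (dual c h).subset := by
  rintro (hi1 | ⟨j, hj, -, hij⟩)
  · omega
  · have := two_le_sizeUpTo_one h
    have := c.monotone_sizeUpTo hj
    omega

theorem vector_dual_one {c : Composition n} (h : ∃ a ∈ c.blocks.head?, 2 ≤ a) {a : SignedPoint n}
    (ha : (a : ℤ) = 1) : (dual c h).vector a = -1 := by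
  have hc := two_le_sizeUpTo_one h
  have := hn.out
  have hlevel := level_eq_one c (by omega) (x := 1) one_pos (by omega)
  simp [vector, IsDual, offset, composition, total, ha, hlevel]

theorem vector_dual_two {c : Composition n} (h : ∃ a ∈ c.blocks.head?, 2 ≤ a) {a : SignedPoint n}
    (ha : (a : ℤ) = 2) : (dual c h).vector a = 1 := by
  have hc := two_le_sizeUpTo_one h
  have := hn.out
  have hlevel := level_eq_one c (by omega) (x := 2) two_pos (by omega)
  simp [vector, offset, composition, total, ha, hlevel]

theorem vector_lo_hi_of_eq_zero (κ : DComposition n) {i : Fin n} (hi0 : (i : ℕ) = 0) :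
    κ.vector (lo i) ≤ κ.vector (hi i) ∧ (κ.vector (lo i) = κ.vector (hi i) ↔ i ∉ κ.subset) := by
  have h2 := hn.out
  have hhi : ((hi i : SignedPoint n) : ℤ) = 2 := by rw [coe_hi, if_pos hi0]
  have hlo : ((-lo i : SignedPoint n) : ℤ) = 1 := by rw [coe_neg, coe_lo, if_pos hi0, neg_neg]
  rw [← neg_neg (lo i), κ.odd_vector]
  cases κ with
  | below m hm c =>
    rw [vector_of_pos _ (by omega) (by simp [IsDual]),
      vector_of_pos _ (by omega) (by simp [IsDual]), hhi, hlo,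
      level_eq_zero _ (by simp only [offset]; omega),
      level_eq_zero _ (by simp only [offset]; omega)]
    simp only [CharP.cast_eq_zero, neg_zero, le_refl, true_and, true_iff]
    rintro ⟨j, -, hj⟩
    omega
  | one c h | top c h =>
    rw [vector_of_pos _ (by omega) (by simp [IsDual]),
      vector_of_pos _ (by omega) (by simp [IsDual]), hhi, hlo]
    have h1 := level_pos c (by omega) (x := 1) one_pos
    have h2 := level_pos c (by omega) (x := 2) two_pos
    simp only [offset, composition, total, subset, Set.mem_ofPred_eq, hi0, true_or, not_true,
      iff_false, Int.natAbs_one, show Int.natAbs 2 = 2 from rfl]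
    omega
  | dual c h =>
    simp [vector_dual_one h hlo, vector_dual_two h hhi, zero_notMem_subset_dual h hi0]

theorem vector_lo_hi_of_ne_zero (κ : DComposition n) {i : Fin n} (hi0 : (i : ℕ) ≠ 0) :
    κ.vector (lo i) ≤ κ.vector (hi i) ∧ (κ.vector (lo i) = κ.vector (hi i) ↔ i ∉ κ.subset) := by
  have hlo : ((lo i : SignedPoint n) : ℤ) = i := by rw [coe_lo, if_neg hi0]
  have hhi : ((hi i : SignedPoint n) : ℤ) = (i + 1 : ℕ) := by rw [coe_hi, if_neg hi0]; simp
  by_cases hd : κ.IsDual ∧ (i : ℕ) = 1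
  · obtain ⟨hd, hi1⟩ := hd
    cases κ with
    | below | one | top => exact hd.elim
    | dual c h =>
      rw [vector_dual_one h (by omega), vector_dual_two h (by omega)]
      simp [subset, hi1]
  · rw [vector_of_pos κ (by omega) (by simpa [hlo] using hd), vector_of_pos κ (by omega) (by omega),
      hlo, hhi, Int.natAbs_natCast, Int.natAbs_natCast, Nat.cast_le, Nat.cast_inj,
      level_eq_level_succ_iff, mem_subset_iff κ hi0 hd]
    exact ⟨level_mono _ _ i.val.le_succ, Iff.rfl⟩

theorem isFaceVector_vector (κ : DComposition n) : IsFaceVector κ.vector κ.subsetᶜ := by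
  have key (i : Fin n) : κ.vector (lo i) ≤ κ.vector (hi i) ∧
      (κ.vector (lo i) = κ.vector (hi i) ↔ i ∉ κ.subset) := by
    by_cases hi0 : (i : ℕ) = 0
    · exact κ.vector_lo_hi_of_eq_zero hi0
    · exact κ.vector_lo_hi_of_ne_zero hi0
  exact ⟨κ.odd_vector, fun i => (key i).1, fun i => (key i).2⟩

end FaceVector

section Surjectivity

variable {n : ℕ}

theorem exists_composition_of_zero_mem (hn : 1 < n) {K : Set ℕ} (hK : 0 ∈ K) :
    ∃ c : Composition n,
      (∀ i < n, (i = 0 ∨ ∃ j, 1 ≤ j ∧ j < c.length ∧ i = c.sizeUpTo j) ↔ i ∈ K) ∧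
      (1 ∈ K → ∃ a ∈ c.blocks.head?, a = 1) ∧ (1 ∉ K → ∃ a ∈ c.blocks.head?, 2 ≤ a) := by
  obtain ⟨c, hc⟩ := exists_composition (m := n) K fun _ => hK
  have hlen : 0 < c.length := c.length_pos_of_pos (by omega)
  have hpos : 0 < c.sizeUpTo 1 := c.sizeUpTo_zero ▸ sizeUpTo_lt_sizeUpTo c one_pos hlen
  refine ⟨c, ?_⟩
  simp only [exists_sizeUpTo_iff c (by omega : 0 < n),
    exists_mem_head?_blocks_iff c (by omega : 0 < n)]
  refine ⟨hc, fun h1 => ?_, fun h1 => ?_⟩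
  · obtain ⟨j, -, hj⟩ := (hc 1 hn).mpr h1
    have hj0 : 1 ≤ j := Nat.pos_of_ne_zero fun h => by simp [h] at hj
    have := c.monotone_sizeUpTo hj0
    omega
  · by_contra! hlt
    have hone : c.sizeUpTo 1 = 1 := by omega
    refine h1 ((hc 1 hn).mp ⟨1, lt_of_not_ge fun hle => ?_, hone⟩)
    rw [c.sizeUpTo_ofLength_le 1 hle] at hone
    omega

theorem exists_subset_eq_of_zero_mem {K : Set (Fin n)} {i₀ : Fin n} (hn : 1 < n)
    (hi₀ : (i₀ : ℕ) = 0) (h0 : i₀ ∈ K) : ∃ κ : DComposition n, κ.subset = K := by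
  obtain ⟨c, hc, hone, htop⟩ := exists_composition_of_zero_mem hn
    (K := Fin.val '' K) ⟨i₀, h0, hi₀⟩
  have hsubset (i : Fin n) :
      ((i : ℕ) = 0 ∨ ∃ j, 1 ≤ j ∧ j < c.length ∧ (i : ℕ) = c.sizeUpTo j) ↔ i ∈ K := by
    rw [hc i i.2, Fin.val_injective.mem_set_image]
  by_cases h1 : 1 ∈ Fin.val '' K
  · exact ⟨one c (hone h1), Set.ext hsubset⟩
  · exact ⟨top c (htop h1), Set.ext hsubset⟩

theorem exists_subset_eq_of_one_mem [Fact (2 ≤ n)] {K : Set (Fin n)} {i₁ : Fin n}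
    (hi₁ : (i₁ : ℕ) = 1) (h1 : i₁ ∈ K) (h0 : ∀ i ∈ K, (i : ℕ) ≠ 0) :
    ∃ κ : DComposition n, κ.subset = K := by
  obtain ⟨c, hc, -, htop⟩ := exists_composition_of_zero_mem (hi₁ ▸ i₁.2)
    (Set.mem_insert 0 (Fin.val '' (K \ {i₁})))
  have hdual := htop (by rintro (h | ⟨i, hi, hi1⟩) <;> grind)
  refine ⟨dual c hdual, Set.ext fun i => ?_⟩
  by_cases hi0 : (i : ℕ) = 0
  · exact iff_of_false (zero_notMem_subset_dual hdual hi0) fun hi => h0 i hi hi0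
  · have hmem := hc i i.2
    simp only [hi0, false_or, Set.mem_insert_iff, Fin.val_injective.mem_set_image, Set.mem_sdiff,
      Set.mem_singleton_iff] at hmem
    simp only [subset, Set.mem_ofPred_eq, hmem]
    by_cases hi1 : i = i₁
    · simp [hi1, hi₁, h1]
    · simp [hi1, show (i : ℕ) ≠ 1 by omega]

theorem exists_subset_eq_of_two_le {K : Set (Fin n)} (hn : 2 ≤ n) (hK : ∀ i ∈ K, 2 ≤ (i : ℕ)) :
    ∃ κ : DComposition n, κ.subset = K := by
  rcases K.eq_empty_or_nonempty with rfl | hne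
  · exact ⟨below 0 hn (Composition.ones 0), by ext i; simp [subset]⟩
  obtain ⟨k, hk, hmin⟩ := K.exists_min_image id K.toFinite hne
  have := hK k hk
  obtain ⟨c, hc⟩ := exists_composition (m := n - k) {i | ∃ x ∈ K, (x : ℕ) = k + i}
    fun _ => ⟨k, hk, rfl⟩
  refine ⟨below (n - k) (by omega) c, Set.ext fun i => ?_⟩
  simp only [subset, Set.mem_ofPred_eq, Nat.sub_sub_self k.2.le]
  constructor
  · rintro ⟨j, hj, hi⟩
    obtain ⟨x, hx, hxj⟩ := (hc _ (by omega)).mp ⟨j, hj, rfl⟩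
    rwa [show i = x by omega]
  · intro hi
    have : (k : ℕ) ≤ i := hmin i hi
    obtain ⟨j, hj, hj'⟩ := (hc (i - k) (by omega)).mpr ⟨i, hi, by omega⟩
    exact ⟨j, hj, by omega⟩

theorem exists_subset_eq [hn : Fact (2 ≤ n)] (K : Set (Fin n)) :
    ∃ κ : DComposition n, κ.subset = K := by
  have h2 := hn.out
  by_cases h0 : (⟨0, by omega⟩ : Fin n) ∈ K
  · exact exists_subset_eq_of_zero_mem (by omega) rfl h0
  have h0 : ∀ i ∈ K, (i : ℕ) ≠ 0 := fun i hi hi0 => h0 (by rwa [← show i = ⟨0, _⟩ from Fin.ext hi0])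
  by_cases h1 : (⟨1, by omega⟩ : Fin n) ∈ K
  · exact exists_subset_eq_of_one_mem rfl h1 h0
  have h1 : ∀ i ∈ K, (i : ℕ) ≠ 1 := fun i hi hi1 => h1 (by rwa [← show i = ⟨1, _⟩ from Fin.ext hi1])
  exact exists_subset_eq_of_two_le h2 fun i hi => by
    have := h0 i hi
    have := h1 i hi
    omega

end Surjectivity

end DComposition

theorem exists_isFaceVector {n : ℕ} [Fact (2 ≤ n)] (J : Set (Fin n)) :
    ∃ v : SignedPoint n → ℤ, IsFaceVector v J := by
  obtain ⟨κ, hκ⟩ := DComposition.exists_subset_eq Jᶜ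
  exact ⟨κ.vector, by simpa [hκ] using κ.isFaceVector_vector⟩

section CosetRepresentatives

variable {n : ℕ} [hn : Fact (2 ≤ n)] {u v : SignedPoint n → ℤ} {J K : Set (Fin n)}
  {w x y : coxeterGroup n}

theorem coxeter_ne_neg (w : coxeterGroup n) {a b : SignedPoint n} (hne : b ≠ -a) :
    w.1 b ≠ -w.1 a := by
  rw [← odd_coxeter w]
  exact w.1.injective.ne hne

theorem coxeter_lo_ne_coxeter_hi (w : coxeterGroup n) (i : Fin n) : w.1 (lo i) ≠ w.1 (hi i) :=
  w.1.injective.ne (lo_lt_hi i).ne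

namespace IsFaceVector

theorem toLex_lt_toLex (hv : IsFaceVector v J) (hw : ∀ i ∈ J, w.1 (lo i) < w.1 (hi i))
    {a b : SignedPoint n} (hab : a < b) (hne : b ≠ -a) :
    toLex (v a, w.1 a) < toLex (v b, w.1 b) := by
  have : IsTrans (SignedPoint n) fun a b => toLex (v a, w.1 a) < toLex (v b, w.1 b) :=
    ⟨fun _ _ _ => lt_trans⟩
  have hlohi (i : Fin n) : v (lo i) < v (hi i) ∨ v (lo i) = v (hi i) ∧ w.1 (lo i) < w.1 (hi i) :=
    (hv.dominant i).lt_or_eq.imp_right fun h => ⟨h, hw i ((hv.eq_iff i).mp h)⟩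
  refine rel_of_rel_lo_hi (r := fun a b => toLex (v a, w.1 a) < toLex (v b, w.1 b))
    (fun i => Prod.Lex.toLex_lt_toLex.mpr (hlohi i))
    (fun i => Prod.Lex.toLex_lt_toLex.mpr ?_) hab hne
  simp only [hv.odd _, odd_coxeter w _]
  refine (hlohi i).imp neg_lt_neg fun h => ⟨congrArg _ h.1.symm, ?_⟩
  rw [← Subtype.coe_lt_coe, coe_neg, coe_neg]
  exact neg_lt_neg h.2

theorem symm_lt_symm (hv : IsFaceVector v J) (hw : ∀ i ∈ J, w.1 (lo i) < w.1 (hi i))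
    (hu : u ∘ w.1 = v) {a b : SignedPoint n} (hne : b ≠ -a)
    (hab : toLex (u a, a) < toLex (u b, b)) : w.1.symm a < w.1.symm b := by
  have hv_symm (c : SignedPoint n) : v (w.1.symm c) = u c := by simp [← hu]
  by_contra! hle
  rcases hle.eq_or_lt with h | h
  · exact hab.ne (by rw [w.1.symm.injective h])
  · refine lt_asymm hab ?_
    have := hv.toLex_lt_toLex hw h fun h' => hne <| by
      rw [← w.1.apply_symm_apply a, h', odd_coxeter w, w.1.apply_symm_apply, neg_neg]
    simpa only [hv_symm, w.1.apply_symm_apply] using this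

theorem eq_of_comp_eq (hv : IsFaceVector v J) (hw : ∀ i ∈ J, w.1 (lo i) < w.1 (hi i))
    (hx : ∀ i ∈ J, x.1 (lo i) < x.1 (hi i)) (hwu : u ∘ w.1 = v) (hxu : u ∘ x.1 = v) : w = x := by
  refine inv_mul_eq_one.mp (eq_one_of_lo_lt_hi fun i => ?_)
  refine hv.symm_lt_symm hw hwu (a := x.1 (lo i)) (b := x.1 (hi i))
    (coxeter_ne_neg x (hi_ne_neg_lo i)) ?_
  have := hv.toLex_lt_toLex hx (lo_lt_hi i) (hi_ne_neg_lo i)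
  rwa [← hxu] at this

theorem comp_gen (hv : IsFaceVector v J) {i : Fin n} (hiJ : i ∈ J) : v ∘ (gen n i).1 = v := by
  have hlohi := (hv.eq_iff i).mpr hiJ
  funext a
  change v (simpleReflection n i a) = v a
  have ha := coe_simpleReflection_apply i a
  have eq_of_coe (x y : SignedPoint n) : (x : ℤ) = y → x = y := Subtype.ext
  split_ifs at ha with h1 h2 h3 h4
  · rw [eq_of_coe _ _ ha, eq_of_coe _ _ h1, hlohi]
  · rw [eq_of_coe _ _ ha, eq_of_coe _ _ h2, hlohi]
  · rw [eq_of_coe _ (-hi i) ha, eq_of_coe _ (-lo i) h3, hv.odd, hv.odd, hlohi]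
  · rw [eq_of_coe _ (-lo i) ha, eq_of_coe _ (-hi i) h4, hv.odd, hv.odd, hlohi]
  · rw [eq_of_coe _ _ ha]

theorem comp_parabolic (hv : IsFaceVector v J) (hw : w ∈ parabolic J) : v ∘ w.1 = v := by
  induction hw using Subgroup.closure_induction with
  | mem _ hx =>
    obtain ⟨i, hiJ, rfl⟩ := hx
    exact hv.comp_gen hiJ
  | one => rfl
  | mul x y _ _ hx hy =>
    change (v ∘ x.1) ∘ y.1 = v
    rw [hx, hy]
  | inv x _ hx =>
    calc v ∘ x⁻¹.1 = (v ∘ x.1) ∘ x⁻¹.1 := by rw [hx]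
      _ = v := by funext a; simp

theorem exists_mem_minReps_comp_eq (hv : IsFaceVector v J) (hu : u ∈ orbit v) :
    ∃ w ∈ minReps J, u ∘ w.1 = v := by
  obtain ⟨x, rfl⟩ := mem_orbit.mp hu
  have : Nonempty {w : coxeterGroup n // (v ∘ x.1) ∘ w.1 = v} := ⟨x⁻¹, by funext a; simp⟩
  obtain ⟨⟨w, hw⟩, hmin⟩ := Finite.exists_min
    fun w : {w : coxeterGroup n // (v ∘ x.1) ∘ w.1 = v} => length w.1
  refine ⟨w, fun u hu => hmin ⟨w * u, ?_⟩, hw⟩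
  change ((v ∘ x.1) ∘ w.1) ∘ u.1 = v
  rw [hw, hv.comp_parabolic hu]

end IsFaceVector

theorem lo_lt_hi_of_mem_minReps (hw : w ∈ minReps J) {i : Fin n} (hiJ : i ∈ J) :
    w.1 (lo i) < w.1 (hi i) := by
  by_contra hle
  have hlt := lt_of_le_of_ne (not_lt.mp hle) (coxeter_lo_ne_coxeter_hi w i).symm
  have hinv := invCount_mul_gen w i
  rw [if_pos hlt, if_neg hle, ← two_mul_length, ← two_mul_length] at hinv
  have : length w ≤ length (w * gen n i) := hw _ (Subgroup.subset_closure ⟨i, hiJ, rfl⟩)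
  omega

theorem mem_minReps_iff : w ∈ minReps J ↔ ∀ i ∈ J, w.1 (lo i) < w.1 (hi i) := by
  refine ⟨fun hw i => lo_lt_hi_of_mem_minReps hw, fun hw => ?_⟩
  obtain ⟨v, hv⟩ := exists_isFaceVector J
  -- The orbit point `v ∘ w⁻¹` belongs to just one element without descents in `J`.
  have hw_inv : v ∘ w⁻¹.1 ∈ orbit v := mem_orbit.mpr ⟨w⁻¹, rfl⟩
  obtain ⟨x, hx, hxv⟩ := hv.exists_mem_minReps_comp_eq hw_inv
  rwa [hv.eq_of_comp_eq hw (fun i => lo_lt_hi_of_mem_minReps hx) (by funext a; simp) hxv]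

end CosetRepresentatives

section Solomon

variable {n : ℕ} [hn : Fact (2 ≤ n)] {u v : SignedPoint n → ℤ} {J K : Set (Fin n)}
  {x x' w w' y : coxeterGroup n}

namespace IsFaceVector

theorem comp_lo_le_comp_hi (hv : IsFaceVector v K) (hw : w ∈ minReps J) {i : Fin n} (hiJ : i ∈ J) :
    (v ∘ w.1) (lo i) ≤ (v ∘ w.1) (hi i) :=
  hv.dominant.le hv.odd (mem_minReps_iff.mp hw i hiJ) (coxeter_ne_neg w (hi_ne_neg_lo i))

theorem mul_mem_minReps (hv : IsFaceVector v K) (hx : x ∈ minReps K) (hw : w ∈ minReps J) :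
    x * w ∈ minReps {i | i ∈ J ∧ (v ∘ w.1) (lo i) = (v ∘ w.1) (hi i)} := by
  rw [mem_minReps_iff] at hx hw ⊢
  rintro i ⟨hiJ, heq⟩
  have hlex := hv.toLex_lt_toLex hx (hw i hiJ) (coxeter_ne_neg w (hi_ne_neg_lo i))
  rcases Prod.Lex.toLex_lt_toLex.mp hlex with h | h
  · exact absurd heq h.ne
  · exact h.2

theorem eq_of_mul_eq_mul (hv : IsFaceVector v K) (hx : x ∈ minReps K) (hx' : x' ∈ minReps K)
    (hw : v ∘ w.1 = v ∘ w'.1) (h : x * w = x' * w') : x = x' := by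
  have hcomp (x w : coxeterGroup n) : ((v ∘ w.1) ∘ (x * w)⁻¹.1) ∘ x.1 = v := by
    funext a
    simp
  refine hv.eq_of_comp_eq (mem_minReps_iff.mp hx) (mem_minReps_iff.mp hx') (hcomp x w) ?_
  rw [hw, h, hcomp]

theorem inv_mul_mem_minReps (hv : IsFaceVector v K) (hle : ∀ i ∈ J, u (lo i) ≤ u (hi i))
    (hy : y ∈ minReps {i | i ∈ J ∧ u (lo i) = u (hi i)}) (hx : x ∈ minReps K)
    (hxu : (u ∘ y⁻¹.1) ∘ x.1 = v) : x⁻¹ * y ∈ minReps J := by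
  rw [mem_minReps_iff] at hx hy ⊢
  intro i hiJ
  refine hv.symm_lt_symm hx hxu (coxeter_ne_neg y (hi_ne_neg_lo i))
    (Prod.Lex.toLex_lt_toLex.mpr ?_)
  simpa using (hle i hiJ).lt_or_eq.imp_right fun h => ⟨h, hy i ⟨hiJ, h⟩⟩

theorem exists_factorization (hv : IsFaceVector v K) (hu : u ∈ orbit v)
    (hle : ∀ i ∈ J, u (lo i) ≤ u (hi i)) (hy : y ∈ minReps {i | i ∈ J ∧ u (lo i) = u (hi i)}) :
    ∃ x ∈ minReps K, ∃ w ∈ minReps J, v ∘ w.1 = u ∧ x * w = y := by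
  obtain ⟨z, rfl⟩ := mem_orbit.mp hu
  obtain ⟨x, hx, hxu⟩ := hv.exists_mem_minReps_comp_eq (u := (v ∘ z.1) ∘ y⁻¹.1)
    (mem_orbit.mpr ⟨z * y⁻¹, rfl⟩)
  refine ⟨x, hx, x⁻¹ * y, hv.inv_mul_mem_minReps hle hy hx hxu, ?_, mul_inv_cancel_left x y⟩
  funext a
  have := congrFun hxu ((x⁻¹ * y).1 a)
  simpa using this.symm

end IsFaceVector

omit hn in
theorem mem_toFinset_minReps : w ∈ (Set.toFinite (minReps J)).toFinset ↔ w ∈ minReps J :=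
  Set.Finite.mem_toFinset _

/-- **Solomon's theorem** for `D_n`. -/
theorem repSum_mul_repSum (hv : IsFaceVector v K) (J : Set (Fin n))
    [DecidablePred fun u : SignedPoint n → ℤ => ∀ i ∈ J, u (lo i) ≤ u (hi i)] :
    repSum K * repSum J = ∑ u ∈ orbit v with ∀ i ∈ J, u (lo i) ≤ u (hi i),
      repSum {i | i ∈ J ∧ u (lo i) = u (hi i)} := by
  classical
  unfold repSum
  rw [Finset.sum_mul_sum, ← Finset.sum_product', Finset.sum_sigma']
  simp only [← map_mul]
  refine Finset.sum_bij (fun x _ => ⟨v ∘ x.2.1, x.1 * x.2⟩) ?_ ?_ ?_ fun _ _ => rfl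
  · rintro ⟨x, w⟩ hxw
    simp only [Finset.mem_product, mem_toFinset_minReps] at hxw
    simp only [Finset.mem_sigma, Finset.mem_filter, mem_toFinset_minReps]
    exact ⟨⟨mem_orbit.mpr ⟨w, rfl⟩, fun i => hv.comp_lo_le_comp_hi hxw.2⟩,
      hv.mul_mem_minReps hxw.1 hxw.2⟩
  · rintro ⟨x, w⟩ hxw ⟨x', w'⟩ hxw' h
    simp only [Finset.mem_product, mem_toFinset_minReps] at hxw hxw'
    obtain ⟨hw, hmul⟩ := Sigma.mk.injEq .. ▸ h
    obtain rfl := hv.eq_of_mul_eq_mul hxw.1 hxw'.1 hw (eq_of_heq hmul)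
    exact congrArg (Prod.mk x) (mul_right_injective x (eq_of_heq hmul))
  · rintro ⟨u, y⟩ huy
    simp only [Finset.mem_sigma, Finset.mem_filter, mem_toFinset_minReps] at huy
    obtain ⟨x, hx, w, hw, rfl, rfl⟩ := hv.exists_factorization huy.1.1 huy.1.2 huy.2
    exact ⟨(x, w), Finset.mem_product.mpr
      ⟨mem_toFinset_minReps.mpr hx, mem_toFinset_minReps.mpr hw⟩, rfl⟩

end Solomon

section Triangular

variable {k R ι : Type*} [CommRing k] [Ring R] [Algebra k R] [PartialOrder ι]
  {b : Module.Basis ι k R} {x u : R} {j : ι}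

/-- The algebra with basis `b` is triangular: left multiplications are given by upper triangular
matrices with respect to the partially ordered basis `b`. -/
def IsTriangular (b : Module.Basis ι k R) : Prop :=
  ∀ i j, b i * b j ∈ Submodule.span k (b '' Set.Iic j)

theorem repr_eq_zero_of_mem_span_Iio (hu : u ∈ Submodule.span k (b '' Set.Iio j)) :
    b.repr u j = 0 := by
  rw [Module.Basis.mem_span_image] at hu
  by_contra hne
  exact lt_irrefl j (hu (Finsupp.mem_support_iff.mpr hne))

namespace IsTriangular

theorem mul_mem (hb : IsTriangular b) (x : R) (j : ι) :
    x * b j ∈ Submodule.span k (b '' Set.Iic j) := by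
  have hle : Submodule.span k (Set.range b) ≤
      (Submodule.span k (b '' Set.Iic j)).comap (LinearMap.mulRight k (b j)) := by
    rw [Submodule.span_le]
    rintro _ ⟨i, rfl⟩
    exact hb i j
  exact hle (b.mem_span x)

theorem mul_mem_Iio (hb : IsTriangular b) (x : R) (hu : u ∈ Submodule.span k (b '' Set.Iio j)) :
    x * u ∈ Submodule.span k (b '' Set.Iio j) := by
  have hle : Submodule.span k (b '' Set.Iio j) ≤
      (Submodule.span k (b '' Set.Iio j)).comap (LinearMap.mulLeft k x) := by
    rw [Submodule.span_le]
    rintro _ ⟨i, hij, rfl⟩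
    exact Submodule.span_mono (Set.image_mono (Set.Iic_subset_Iio.mpr hij)) (hb.mul_mem x i)
  exact hle hu

theorem mul_sub_mem (hb : IsTriangular b) (x : R) (j : ι) :
    x * b j - b.repr (x * b j) j • b j ∈ Submodule.span k (b '' Set.Iio j) := by
  have hmem := hb.mul_mem x j
  rw [← Set.Iio_insert, Set.image_insert_eq, Submodule.mem_span_insert] at hmem
  obtain ⟨a, z, hz, hxz⟩ := hmem
  have hrepr : b.repr (x * b j) j = a := by
    rw [hxz, map_add, map_smul, Finsupp.add_apply, repr_eq_zero_of_mem_span_Iio hz]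
    simp
  rwa [hrepr, hxz, add_sub_cancel_left]

/-- The character of a triangular algebra that sends `x` to the diagonal entry with index `j` of
the left multiplication by `x`. -/
noncomputable def diagonal (hb : IsTriangular b) (j : ι) : R →ₐ[k] k :=
  AlgHom.ofLinearMap (b.coord j ∘ₗ LinearMap.mulRight k (b j)) (by simp) fun x y => by
    have hzero := repr_eq_zero_of_mem_span_Iio (hb.mul_mem_Iio x (hb.mul_sub_mem y j))
    rw [mul_sub, mul_smul_comm, map_sub, map_smul, Finsupp.sub_apply, Finsupp.smul_apply,
      sub_eq_zero, ← mul_assoc] at hzero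
    simpa [mul_comm] using hzero

theorem mul_sub_diagonal_smul_mem (hb : IsTriangular b) (x : R) (j : ι) :
    x * b j - hb.diagonal j x • b j ∈ Submodule.span k (b '' Set.Iio j) :=
  hb.mul_sub_mem x j

theorem diagonal_eq (hb : IsTriangular b) {a : k}
    (h : x * b j - a • b j ∈ Submodule.span k (b '' Set.Iio j)) : hb.diagonal j x = a := by
  have hzero := repr_eq_zero_of_mem_span_Iio h
  rw [map_sub, map_smul, Finsupp.sub_apply, Finsupp.smul_apply, sub_eq_zero] at hzero
  exact hzero.trans (by simp)

variable {A : Type*} [Ring A] [Algebra k A] [WellFoundedLT ι]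

theorem isNilpotent_map (hb : IsTriangular b) (f : R →ₐ[k] A)
    (hx : ∀ j, algebraMap k A (hb.diagonal j x) = 0) : IsNilpotent (f x) := by
  set N := (Module.End.maxGenEigenspace (LinearMap.mulLeft k (f x)) 0).comap f.toLinearMap with hN
  have mem_N (u : R) : u ∈ N ↔ ∃ m : ℕ, f x ^ m * f u = 0 := by
    simp [hN, Module.End.mem_maxGenEigenspace, LinearMap.pow_mulLeft]
  have basis_mem (j : ι) : b j ∈ N := by
    induction j using WellFoundedLT.induction with
    | _ j ih =>
      have hle : Submodule.span k (b '' Set.Iio j) ≤ N :=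
        Submodule.span_le.mpr (Set.image_subset_iff.mpr ih)
      obtain ⟨m, hm⟩ := (mem_N _).mp (hle (hb.mul_sub_diagonal_smul_mem x j))
      refine (mem_N _).mpr ⟨m + 1, ?_⟩
      rwa [map_sub, map_smul, Algebra.smul_def, hx, zero_mul, sub_zero, map_mul, ← mul_assoc,
        ← pow_succ] at hm
  have one_mem : (1 : R) ∈ N :=
    Submodule.span_le.mpr (Set.range_subset_iff.mpr basis_mem) (b.mem_span 1)
  obtain ⟨m, hm⟩ := (mem_N 1).mp one_mem
  exact ⟨m, by simpa using hm⟩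

theorem mem_jacobson_iff {F : Type*} [Field F] [Algebra k F] (hb : IsTriangular b)
    {f : R →ₐ[k] A} (hf : Function.Surjective f)
    (hk : ∀ c : k, algebraMap k F c = 0 → algebraMap k A c = 0) {χ : ι → A →+* F}
    (hχ_surj : ∀ j, Function.Surjective (χ j))
    (hχ : ∀ j x, χ j (f x) = algebraMap k F (hb.diagonal j x)) {a : A} :
    a ∈ Ring.jacobson A ↔ ∀ j, χ j a = 0 := by
  refine ⟨fun ha j => ?_, fun ha => ?_⟩
  · have hmax : (RingHom.ker (χ j)).IsMaximal :=
      RingHom.ker_isMaximal_of_surjective _ (hχ_surj j)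
    rw [Ring.jacobson_eq_sInf_isMaximal] at ha
    exact Submodule.mem_sInf.mp ha _ hmax
  · rw [← Ideal.jacobson_bot, Ideal.mem_jacobson_iff]
    intro y
    obtain ⟨x, hx⟩ := hf (y * a)
    have hnil : IsNilpotent (y * a) := by
      rw [← hx]
      refine hb.isNilpotent_map f fun j => hk _ ?_
      rw [← hχ, hx, map_mul, ha, mul_zero]
    obtain ⟨z, hz⟩ := hnil.isUnit_add_one.exists_left_inv
    refine ⟨z, ?_⟩
    rw [Ideal.mem_bot, mul_assoc, ← mul_add_one, hz, sub_self]

end IsTriangular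

end Triangular

section DescentRing

variable {n : ℕ} [hn : Fact (2 ≤ n)] {v : SignedPoint n → ℤ} {J K : Set (Fin n)}

omit hn in
theorem coeff_repSum (J : Set (Fin n)) (w : coxeterGroup n) [Decidable (w ∈ minReps J)] :
    (repSum J).coeff w = if w ∈ minReps J then 1 else 0 := by
  classical
  rw [repSum, MonoidAlgebra.coeff_sum, Finsupp.finsetSum_apply]
  simp only [MonoidAlgebra.of_apply, MonoidAlgebra.coeff_single, Finsupp.single_apply]
  rw [Finset.sum_ite_eq']
  simp

theorem IsDominant.symm_lt_symm {w : coxeterGroup n} (dv : IsDominant (v ∘ w.1)) (hv : v.Odd)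
    {a b : SignedPoint n} (hne : b ≠ -a) (hab : v a < v b) : w.1.symm a < w.1.symm b := by
  have hv_symm (c : SignedPoint n) : (v ∘ w.1) (w.1.symm c) = v c := by simp
  by_contra! hle
  rcases hle.eq_or_lt with h | h
  · exact hab.ne (by rw [w.1.symm.injective h])
  · have := dv.le (hv.comp_odd (odd_coxeter w)) h fun h' => hne <| by
      rw [← w.1.apply_symm_apply a, h', odd_coxeter w, w.1.apply_symm_apply, neg_neg]
    rw [hv_symm, hv_symm] at this
    exact hab.not_ge this

theorem exists_ascents_eq (J : Set (Fin n)) :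
    ∃ w : coxeterGroup n, ∀ i, w.1 (lo i) < w.1 (hi i) ↔ i ∈ J := by
  obtain ⟨v, hv⟩ := exists_isFaceVector Jᶜ
  -- Sort by `v`, and in reverse order where `v` is constant.
  set u : SignedPoint n → ℤ := fun a => (2 * n + 1) * v a - a with hu
  have hodd : u.Odd := fun a => by simp only [hu, hv.odd a, coe_neg]; ring
  obtain ⟨w, hw⟩ := exists_isDominant_comp hodd
  refine ⟨w⁻¹, fun i => ?_⟩
  have hlt : (lo i : ℤ) < hi i := lo_lt_hi i
  have := (lo i).2
  have := (hi i).2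
  by_cases hiJ : i ∈ J
  · have hv_lt : v (lo i) < v (hi i) :=
      (hv.dominant i).lt_of_ne fun h => (hv.eq_iff i).mp h hiJ
    have hu_lt : u (lo i) < u (hi i) := by simp only [hu]; nlinarith
    exact iff_of_true (hw.symm_lt_symm hodd (hi_ne_neg_lo i) hu_lt) hiJ
  · have hv_eq : v (lo i) = v (hi i) := (hv.eq_iff i).mpr hiJ
    have hu_lt : u (hi i) < u (lo i) := by simp only [hu, hv_eq]; omega
    have hne : lo i ≠ -hi i := fun h => hi_ne_neg_lo i (by rw [h, neg_neg])
    exact iff_of_false (hw.symm_lt_symm hodd hne hu_lt).asymm hiJ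

/-- The sum `𝒳_J` as an element of the descent ring. -/
noncomputable def rep (J : Set (Fin n)) : descentRing n :=
  ⟨repSum J, Subring.subset_closure ⟨J, rfl⟩⟩

theorem sum_subset_eq_zero [DecidableRel ((· ⊆ ·) : Set (Fin n) → Set (Fin n) → Prop)]
    {c : Set (Fin n) → ℤ} (hc : ∑ J, c J • repSum J = (0 : MonoidAlgebra ℤ (coxeterGroup n)))
    (L : Set (Fin n)) : ∑ J : Set (Fin n) with J ⊆ L, c J = 0 := by
  classical
  obtain ⟨w, hw⟩ := exists_ascents_eq L
  have hcoeff := congrArg (fun x => x.coeff w) hc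
  simp only [MonoidAlgebra.coeff_sum, Finsupp.finsetSum_apply, MonoidAlgebra.coeff_smul_apply,
    coeff_repSum, mem_minReps_iff, hw, MonoidAlgebra.coeff_zero, Finsupp.coe_zero,
    Pi.zero_apply, smul_eq_mul, mul_ite, mul_one, mul_zero] at hcoeff
  rw [Finset.sum_filter]
  exact (Finset.sum_congr rfl fun J _ => by congr).trans hcoeff

theorem linearIndependent_rep : LinearIndependent ℤ (rep : Set (Fin n) → descentRing n) := by
  classical
  rw [Fintype.linearIndependent_iff]
  intro c hc J
  have hcoe : ∑ J, c J • repSum J = (0 : MonoidAlgebra ℤ (coxeterGroup n)) := by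
    simpa [rep] using congrArg ((↑) : descentRing n → MonoidAlgebra ℤ (coxeterGroup n)) hc
  induction J using WellFoundedLT.induction with
  | _ J ih =>
    rw [← sum_subset_eq_zero hcoe J, Finset.sum_eq_single_of_mem J (by simp)]
    exact fun I hI hne => ih I ((Finset.mem_filter.mp hI).2.lt_of_ne hne)

theorem rep_univ : rep (Set.univ : Set (Fin n)) = 1 := by
  have huniv : (Set.toFinite (minReps (Set.univ : Set (Fin n)))).toFinset = {1} := by
    ext w
    rw [mem_toFinset_minReps, mem_minReps_iff, Finset.mem_singleton]
    refine ⟨fun h => eq_one_of_lo_lt_hi fun i => h i trivial, ?_⟩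
    rintro rfl i _
    exact lo_lt_hi i
  apply Subtype.ext
  change repSum Set.univ = 1
  rw [repSum, huniv, Finset.sum_singleton, map_one]

/-- The number of vectors in the orbit of `v` that are fixed by the generators in `J`. -/
noncomputable def fixCount (v : SignedPoint n → ℤ) (J : Set (Fin n)) : ℕ :=
  open Classical in
  ((orbit v).filter fun u : SignedPoint n → ℤ => ∀ i ∈ J, u (lo i) = u (hi i)).card

theorem rep_mul_rep (hv : IsFaceVector v K) (J : Set (Fin n))
    [DecidablePred fun u : SignedPoint n → ℤ => ∀ i ∈ J, u (lo i) ≤ u (hi i)] :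
    rep K * rep J = ∑ u ∈ orbit v with ∀ i ∈ J, u (lo i) ≤ u (hi i),
      rep {i | i ∈ J ∧ u (lo i) = u (hi i)} := by
  apply Subtype.ext
  rw [AddSubmonoidClass.coe_finsetSum]
  exact repSum_mul_repSum hv J

theorem rep_mul_rep_sub_mem (hv : IsFaceVector v K) (J : Set (Fin n)) :
    rep K * rep J - (fixCount v J : ℤ) • rep J ∈ Submodule.span ℤ (rep '' Set.Iio J) := by
  classical
  have fixed_iff (u : SignedPoint n → ℤ) : {i | i ∈ J ∧ u (lo i) = u (hi i)} = J ↔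
      ∀ i ∈ J, u (lo i) = u (hi i) := Set.sep_eq_self_iff_mem_true
  have hfixed : ∑ u ∈ (orbit v).filter (fun u => ∀ i ∈ J, u (lo i) = u (hi i)),
      rep (n := n) {i | i ∈ J ∧ u (lo i) = u (hi i)} = (fixCount v J : ℤ) • rep J := by
    rw [fixCount, natCast_zsmul]
    refine Finset.sum_eq_card_nsmul fun u hu => ?_
    rw [(fixed_iff u).mpr (Finset.mem_filter.mp hu).2]
  have hfilter : (orbit v).filter (fun u => (∀ i ∈ J, u (lo i) ≤ u (hi i)) ∧
      ∀ i ∈ J, u (lo i) = u (hi i)) = (orbit v).filter fun u => ∀ i ∈ J, u (lo i) = u (hi i) :=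
    Finset.filter_congr fun u _ => and_iff_right_of_imp fun h i hi => (h i hi).le
  rw [rep_mul_rep hv,
    ← Finset.sum_filter_add_sum_filter_not _ (fun u => ∀ i ∈ J, u (lo i) = u (hi i)),
    Finset.filter_filter, Finset.filter_filter, hfilter, hfixed, add_sub_cancel_left]
  refine Submodule.sum_mem _ fun u hu => Submodule.subset_span ⟨_, ?_, rfl⟩
  exact (Set.sep_subset _ _).lt_of_ne ((fixed_iff u).not.mpr (Finset.mem_filter.mp hu).2.2)

theorem rep_mul_rep_mem (K J : Set (Fin n)) :
    rep K * rep J ∈ Submodule.span ℤ (rep '' Set.Iic J) := by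
  classical
  obtain ⟨v, hv⟩ := exists_isFaceVector K
  rw [rep_mul_rep hv]
  exact Submodule.sum_mem _ fun u _ =>
    Submodule.subset_span ⟨_, Set.sep_subset J fun i => u (lo i) = u (hi i), rfl⟩

theorem span_rep : Submodule.span ℤ (Set.range (rep : Set (Fin n) → descentRing n)) = ⊤ := by
  set S := Submodule.span ℤ (Set.range (rep : Set (Fin n) → descentRing n)) with hS
  have mul_le : S * S ≤ S := by
    rw [hS, Submodule.span_mul_span, Submodule.span_le]
    rintro _ ⟨_, ⟨K, rfl⟩, _, ⟨J, rfl⟩, rfl⟩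
    exact Submodule.span_mono (Set.image_subset_range _ _) (rep_mul_rep_mem K J)
  rw [eq_top_iff]
  rintro ⟨x, hx⟩ -
  induction hx using Subring.closure_induction with
  | mem x hx =>
    obtain ⟨J, rfl⟩ := hx
    exact Submodule.subset_span ⟨J, rfl⟩
  | zero => exact zero_mem _
  | one => exact Submodule.subset_span ⟨Set.univ, rep_univ⟩
  | add x y _ _ hx hy => exact add_mem hx hy
  | neg x _ hx => exact neg_mem hx
  | mul x y _ _ hx hy =>
    have hmul := MulMemClass.mk_mul_mk (descentRing n) x y ‹_› ‹_›
    rw [← hmul]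
    exact mul_le (Submodule.mul_mem_mul hx hy)

variable (n) in
/-- The `ℤ`-basis of the descent ring that consists of the sums `𝒳_J`. -/
noncomputable def descentBasis : Module.Basis (Set (Fin n)) ℤ (descentRing n) :=
  Module.Basis.mk linearIndependent_rep span_rep.ge

theorem coe_descentBasis : ⇑(descentBasis n) = rep := Module.Basis.coe_mk _ _

theorem isTriangular_descentBasis : IsTriangular (descentBasis n) := by
  intro K J
  rw [coe_descentBasis]
  exact rep_mul_rep_mem K J

theorem diagonal_rep (hv : IsFaceVector v K) (J : Set (Fin n)) :
    isTriangular_descentBasis.diagonal J (rep K) = fixCount v J := by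
  apply isTriangular_descentBasis.diagonal_eq
  rw [coe_descentBasis]
  exact rep_mul_rep_sub_mem hv J

end DescentRing

section ModularDescentAlgebra

variable {n : ℕ} (p : ℕ)

theorem natCast_modularDescentAlgebra : (p : ModularDescentAlgebra n p) = 0 := by
  rw [← map_natCast (Ideal.Quotient.mk (multiples n p)), Ideal.Quotient.eq_zero_iff_mem]
  exact ⟨1, by rw [nsmul_eq_mul, mul_one]⟩

variable [Fact (2 ≤ n)]

/-- The reduction modulo `p` of the diagonal character with index `J`. -/
noncomputable def character (J : Set (Fin n)) : ModularDescentAlgebra n p →+* ZMod p :=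
  Ideal.Quotient.lift (multiples n p)
    ((Int.castRingHom (ZMod p)).comp (isTriangular_descentBasis.diagonal J : _ →+* ℤ)) (by
      rintro _ ⟨y, rfl⟩
      simp)

theorem character_mk (J : Set (Fin n)) (x : descentRing n) :
    character p J (Ideal.Quotient.mk (multiples n p) x) =
      (isTriangular_descentBasis.diagonal J x : ZMod p) := rfl

theorem character_smul (J : Set (Fin n)) (c : ZMod p) (x : ModularDescentAlgebra n p) :
    character p J (c • x) = c * character p J x :=
  ((character p J).toAddMonoidHom.toZModLinearMap p).map_smul c x

theorem mem_radical_iff [Fact p.Prime] {x : ModularDescentAlgebra n p} :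
    x ∈ radical n p ↔ ∀ J, character p J x = 0 := by
  refine isTriangular_descentBasis.mem_jacobson_iff
    (f := (Ideal.Quotient.mk (multiples n p)).toIntAlgHom) Ideal.Quotient.mk_surjective
    (fun c hc => ?_) (fun J => ZMod.ringHom_surjective _) fun J x => character_mk p J x
  obtain ⟨d, rfl⟩ := (ZMod.intCast_zmod_eq_zero_iff_dvd c p).mp hc
  simp [natCast_modularDescentAlgebra]

end ModularDescentAlgebra

section Multiplicities

variable {n : ℕ} {u v : SignedPoint n → ℤ}

/-- The number of coordinates of `v` with absolute value `t`. -/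
noncomputable def mult (v : SignedPoint n → ℤ) (t : ℕ) : ℕ :=
  ((positives n).filter fun a => (v a).natAbs = t).card

theorem card_fiber_eq_mult (hv : v.Odd) {t : ℤ} (ht : t ≠ 0) :
    (Finset.univ.filter fun a => v a = t).card = mult v t.natAbs := by
  refine Finset.card_nbij' (fun a => if 0 < (a : ℤ) then a else -a)
    (fun a => if v a = t then a else -a) ?_ ?_ ?_ ?_ <;>
  · intro a ha
    have := a.2
    have := hv a
    simp only [Finset.coe_filter, Finset.mem_univ, true_and, mem_positives,
      Set.mem_ofPred_eq] at ha ⊢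
    grind [coe_neg, neg_neg]

theorem mult_comp_perm (hv : v.Odd) {w : Equiv.Perm (SignedPoint n)} (hvw : (v ∘ w).Odd) {t : ℕ}
    (ht : 0 < t) : mult (v ∘ w) t = mult v t := by
  have ht' : (t : ℤ) ≠ 0 := by exact_mod_cast ht.ne'
  rw [← Int.natAbs_natCast t, ← card_fiber_eq_mult hvw ht', ← card_fiber_eq_mult hv ht']
  exact Finset.card_equiv w fun a => by simp

theorem mult_pos_iff (hv : v.Odd) {t : ℕ} : 0 < mult v t ↔ ∃ a, (v a).natAbs = t := by
  rw [mult, Finset.card_pos]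
  constructor
  · rintro ⟨a, ha⟩
    exact ⟨a, (Finset.mem_filter.mp ha).2⟩
  · rintro ⟨a, rfl⟩
    rcases lt_or_gt_of_ne a.2.1 with ha | ha
    · exact ⟨-a, by simpa [hv a] using ha⟩
    · exact ⟨a, by simpa using ha⟩

theorem card_zeros_eq (hu : u.Odd) (hv : v.Odd) (h : ∀ t, 0 < t → mult u t = mult v t) :
    (Finset.univ.filter fun a => u a = 0).card = (Finset.univ.filter fun a => v a = 0).card := by
  let S : Finset ℤ := insert 0 (Finset.univ.image u ∪ Finset.univ.image v)
  have card_eq (x : SignedPoint n → ℤ) (hx : ∀ a, x a ∈ S) :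
      (Finset.univ.filter fun a => x a = 0).card +
        ∑ t ∈ S.erase 0, (Finset.univ.filter fun a => x a = t).card =
      Fintype.card (SignedPoint n) := by
    rw [Finset.add_sum_erase S (fun t => (Finset.univ.filter fun a => x a = t).card)
      (Finset.mem_insert_self _ _), ← Finset.card_univ]
    exact (Finset.card_eq_sum_card_fiberwise fun a _ => hx a).symm
  have hsum : ∑ t ∈ S.erase 0, (Finset.univ.filter fun a => u a = t).card =
      ∑ t ∈ S.erase 0, (Finset.univ.filter fun a => v a = t).card := by
    refine Finset.sum_congr rfl fun t ht => ?_
    have ht := Finset.ne_of_mem_erase ht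
    rw [card_fiber_eq_mult hu ht, card_fiber_eq_mult hv ht, h _ (Int.natAbs_pos.mpr ht)]
  have := card_eq u fun a => by simp [S]
  have := card_eq v fun a => by simp [S]
  omega

theorem exists_eq_comp_perm (hu : u.Odd) (hv : v.Odd) (h : ∀ t, 0 < t → mult u t = mult v t) :
    ∃ π : Equiv.Perm (SignedPoint n), u = v ∘ π := by
  have fiberEquiv (t : ℤ) : Nonempty ({a // u a = t} ≃ {a // v a = t}) := by
    rw [← Fintype.card_eq, Fintype.card_subtype, Fintype.card_subtype]
    by_cases ht : t = 0
    · subst ht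
      exact card_zeros_eq hu hv h
    · rw [card_fiber_eq_mult hu ht, card_fiber_eq_mult hv ht, h _ (Int.natAbs_pos.mpr ht)]
  exact ⟨Equiv.ofFiberEquiv fun t => (fiberEquiv t).some,
    funext fun a => (Equiv.ofFiberEquiv_map _ a).symm⟩

theorem mem_orbit_of_mult_eq [Fact (2 ≤ n)] (hu : u.Odd) (hv : v.Odd)
    (h : ∀ t, 0 < t → mult u t = mult v t) (hs : posSign u = posSign v) : u ∈ orbit v :=
  (mem_orbit_iff hv).mpr ⟨hu, exists_eq_comp_perm hu hv h, hs⟩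

theorem apply_ne_zero_of_posSign_ne_zero (hv : v.Odd) (h : posSign v ≠ 0) (a : SignedPoint n) :
    v a ≠ 0 := by
  have hpos (b : SignedPoint n) (hb : 0 < (b : ℤ)) : v b ≠ 0 := fun h0 =>
    Finset.prod_ne_zero_iff.mp h b (mem_positives.mpr hb) (by rw [h0, Int.sign_zero])
  rcases lt_or_gt_of_ne a.2.1 with ha | ha
  · rw [← neg_ne_zero, ← hv]
    exact hpos (-a) (by rw [coe_neg]; omega)
  · exact hpos a ha

theorem posSign_neg (v : SignedPoint n → ℤ) :
    posSign (-v) = (-1) ^ (positives n).card * posSign v := by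
  simp only [posSign, Pi.neg_apply, Int.sign_neg, Finset.prod_neg]

end Multiplicities

section ValueSymmetries

/-- The odd function on `ℤ` that multiplies the numbers of absolute value `t` by `ε t`. -/
def signFlip (ε : ℕ → ℤˣ) (z : ℤ) : ℤ := ε z.natAbs * z

/-- The odd function on `ℤ` that sends `j + 1` to `σ j + 1`. -/
def permAbs (σ : Equiv.Perm ℕ) (z : ℤ) : ℤ := z.sign * (σ (z.natAbs - 1) + 1 : ℕ)

variable (ε : ℕ → ℤˣ) (σ τ : Equiv.Perm ℕ)

theorem odd_signFlip : (signFlip ε).Odd := fun z => by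
  simp [signFlip]

theorem natAbs_signFlip (z : ℤ) : (signFlip ε z).natAbs = z.natAbs := by
  rw [signFlip, Int.natAbs_mul, Int.units_natAbs, one_mul]

theorem sign_signFlip (z : ℤ) : (signFlip ε z).sign = ε z.natAbs * z.sign := by
  rw [signFlip, Int.sign_mul]
  rcases Int.units_eq_one_or (ε z.natAbs) with h | h <;> simp [h]

theorem signFlip_involutive : (signFlip ε).Involutive := fun z => by
  rw [signFlip, natAbs_signFlip, signFlip, ← mul_assoc, ← Units.val_mul, Int.units_mul_self,
    Units.val_one, one_mul]

theorem signFlip_mul (δ : ℕ → ℤˣ) : signFlip (ε * δ) = signFlip ε ∘ signFlip δ := by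
  funext z
  rw [Function.comp_apply, signFlip, signFlip, natAbs_signFlip, signFlip, Pi.mul_apply,
    Units.val_mul, mul_assoc]

theorem odd_permAbs : (permAbs σ).Odd := fun z => by
  simp [permAbs]

theorem natAbs_permAbs {z : ℤ} (hz : z ≠ 0) : (permAbs σ z).natAbs = σ (z.natAbs - 1) + 1 := by
  rw [permAbs, Int.natAbs_mul, Int.natAbs_sign_of_ne_zero hz, one_mul, Int.natAbs_natCast]

theorem sign_permAbs (z : ℤ) : (permAbs σ z).sign = z.sign := by
  rw [permAbs, Int.sign_mul, Int.sign_sign,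
    Int.sign_eq_one_of_pos (Int.natCast_pos.mpr (Nat.succ_pos _)), mul_one]

theorem permAbs_one : permAbs 1 = id := by
  funext z
  rcases eq_or_ne z 0 with rfl | hz
  · rfl
  · have hz := Int.natAbs_pos.mpr hz
    rw [permAbs, Equiv.Perm.one_apply, Nat.sub_add_cancel hz, Int.sign_mul_natAbs, id]

theorem permAbs_comp : permAbs σ ∘ permAbs τ = permAbs (σ * τ) := by
  funext z
  rcases eq_or_ne z 0 with rfl | hz
  · simp [permAbs]
  · rw [Function.comp_apply, permAbs, sign_permAbs, natAbs_permAbs τ hz, Nat.add_sub_cancel]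
    rfl

theorem iterate_permAbs (k : ℕ) : (permAbs σ)^[k] = permAbs (σ ^ k) := by
  induction k with
  | zero => rw [pow_zero, permAbs_one, Function.iterate_zero]
  | succ k ih => rw [Function.iterate_succ', ih, permAbs_comp, pow_succ']

theorem permAbs_injective : (permAbs σ).Injective := by
  refine Function.LeftInverse.injective (g := permAbs σ⁻¹) fun z => ?_
  rw [← Function.comp_apply (f := permAbs σ⁻¹), permAbs_comp, inv_mul_cancel, permAbs_one, id]

variable {n : ℕ} (v : SignedPoint n → ℤ)

theorem mult_signFlip (t : ℕ) : mult (signFlip ε ∘ v) t = mult v t := by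
  simp only [mult, Function.comp_apply, natAbs_signFlip]

theorem posSign_signFlip :
    posSign (signFlip ε ∘ v) = (∏ a ∈ positives n, (ε (v a).natAbs : ℤ)) * posSign v := by
  rw [posSign, posSign, ← Finset.prod_mul_distrib]
  exact Finset.prod_congr rfl fun a _ => sign_signFlip ε (v a)

theorem posSign_signFlip_mulSingle (t : ℕ) :
    posSign (signFlip (Pi.mulSingle t (-1)) ∘ v) = (-1) ^ mult v t * posSign v := by
  rw [posSign_signFlip, mult, ← Finset.prod_const, Finset.prod_filter]
  congr 1
  refine Finset.prod_congr rfl fun a _ => ?_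
  rw [Pi.mulSingle_apply]
  split_ifs <;> rfl

theorem mult_permAbs (j : ℕ) : mult (permAbs σ ∘ v) (σ j + 1) = mult v (j + 1) := by
  rw [mult, mult]
  congr 1
  refine Finset.filter_congr fun a _ => ?_
  rcases eq_or_ne (v a) 0 with ha | ha
  · simp [ha, permAbs]
  · have := Int.natAbs_pos.mpr ha
    rw [Function.comp_apply, natAbs_permAbs σ ha, Nat.add_right_cancel_iff, σ.apply_eq_iff_eq]
    omega

theorem posSign_permAbs : posSign (permAbs σ ∘ v) = posSign v :=
  Finset.prod_congr rfl fun a _ => sign_permAbs σ (v a)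

end ValueSymmetries

section FixedVectors

variable {n : ℕ} {v v' w : SignedPoint n → ℤ} {h : ℤ → ℤ}

/-- The members of the orbit of `v` that factor through `w`. If `w` is the face vector of a standard
parabolic subgroup, these are the members fixed by that subgroup. -/
noncomputable def fixed (v w : SignedPoint n → ℤ) : Finset (SignedPoint n → ℤ) :=
  open Classical in (orbit v).filter fun u => u.FactorsThrough w

theorem mem_fixed {u : SignedPoint n → ℤ} : u ∈ fixed v w ↔ u ∈ orbit v ∧ u.FactorsThrough w := by
  simp [fixed]

theorem comp_mem_orbit (hv : h ∘ v ∈ orbit v') {u : SignedPoint n → ℤ} (hu : u ∈ orbit v) :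
    h ∘ u ∈ orbit v' := by
  obtain ⟨x, hx⟩ := mem_orbit.mp hv
  obtain ⟨y, rfl⟩ := mem_orbit.mp hu
  refine mem_orbit.mpr ⟨x * y, ?_⟩
  change (v' ∘ x.1) ∘ y.1 = h ∘ v ∘ y.1
  rw [hx, Function.comp_assoc]

theorem comp_mem_fixed (hv : h ∘ v ∈ orbit v') {u : SignedPoint n → ℤ} (hu : u ∈ fixed v w) :
    h ∘ u ∈ fixed v' w :=
  mem_fixed.mpr ⟨comp_mem_orbit hv (mem_fixed.mp hu).1,
    fun _ _ hab => congrArg h ((mem_fixed.mp hu).2 hab)⟩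

theorem card_fixed_le (hh : h.Injective) (hv : h ∘ v ∈ orbit v') :
    (fixed v w).card ≤ (fixed v' w).card :=
  Finset.card_le_card_of_injOn (h ∘ ·) (fun _ hu => comp_mem_fixed hv hu) hh.comp_left.injOn

theorem dvd_card_fixed {p : ℕ} [Fact p.Prime] (hp : h^[p] = id) (hv : h ∘ v ∈ orbit v)
    {a : SignedPoint n} (ha : h (v a) ≠ v a) : p ∣ (fixed v w).card := by
  classical
  let f : Function.End (fixed v w) := fun u => ⟨h ∘ u.1, comp_mem_fixed hv u.2⟩
  have hf : f ^ p ^ 1 = 1 := by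
    funext u
    refine Subtype.ext (funext fun b => ?_)
    have heval : Function.Semiconj (fun u : fixed v w => u.1 b) f h := fun _ => rfl
    rw [pow_one]
    exact (heval.iterate_right p u).trans (congrFun hp _)
  have hfree : IsEmpty f.fixedPoints := by
    refine ⟨fun ⟨u, hu⟩ => ha ?_⟩
    obtain ⟨x, hx⟩ := mem_orbit.mp (mem_fixed.mp u.2).1
    have hux : h ∘ u.1 = u.1 := congrArg Subtype.val hu
    simpa [← hx] using congrFun hux (x.1.symm a)
  have hmod := Equiv.Perm.card_fixedPoints_modEq hf
  rw [Fintype.card_coe, Fintype.card_eq_zero_iff.mpr hfree] at hmod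
  exact (Nat.modEq_zero_iff_dvd).mp hmod

theorem posSign_eq_of_factorsThrough {u : SignedPoint n → ℤ} (hu : u.Odd) (hw : w.Odd)
    (huw : u.FactorsThrough w) (hu0 : posSign u ≠ 0) (hw0 : posSign w ≠ 0)
    (heven : ∀ t, 0 < t → Even (mult w t)) : posSign u = posSign w := by
  let s (a : SignedPoint n) : ℤ := (u a).sign * (w a).sign
  have hs_sq (a : SignedPoint n) : s a ^ 2 = 1 := by
    rw [← sq_abs, abs_mul, Int.abs_sign_of_ne_zero (apply_ne_zero_of_posSign_ne_zero hu hu0 a),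
      Int.abs_sign_of_ne_zero (apply_ne_zero_of_posSign_ne_zero hw hw0 a), one_mul, one_pow]
  have hs : s.FactorsThrough fun a => (w a).natAbs := by
    intro a b hab
    rcases Int.natAbs_eq_natAbs_iff.mp hab with hab | hab
    · simp only [s, hab, huw hab]
    · rw [← hw b] at hab
      simp [s, hab, huw hab, hu b, hw b]
  have hprod : posSign u * posSign w = 1 := by
    rw [posSign, posSign, ← Finset.prod_mul_distrib,
      ← Finset.prod_fiberwise_of_maps_to (g := fun a => (w a).natAbs)
        (fun a ha => Finset.mem_image_of_mem (fun a => (w a).natAbs) ha)]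
    refine Finset.prod_eq_one fun t ht => ?_
    obtain ⟨b, -, rfl⟩ := Finset.mem_image.mp ht
    obtain ⟨k, hk⟩ :=
      heven _ (Int.natAbs_pos.mpr (apply_ne_zero_of_posSign_ne_zero hw hw0 b))
    rw [Finset.prod_congr rfl fun a ha => hs (Finset.mem_filter.mp ha).2, Finset.prod_const,
      ← mult, hk, ← two_mul, pow_mul, hs_sq, one_pow]
  rcases Int.mul_eq_one_iff_eq_one_or_neg_one.mp hprod with ⟨hu1, hw1⟩ | ⟨hu1, hw1⟩ <;>
    rw [hu1, hw1]

variable [hn : Fact (2 ≤ n)] {J : Set (Fin n)}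

theorem IsFaceVector.eq_of_fixed_of_lt (hw : IsFaceVector w J) {u : SignedPoint n → ℤ} (hu : u.Odd)
    (h : ∀ i ∈ J, u (lo i) = u (hi i)) {a b : SignedPoint n} (hab : a < b) (hne : b ≠ -a)
    (hwab : w a = w b) : u a = u b := by
  let r (a b : SignedPoint n) : Prop := w a < w b ∨ w a = w b ∧ u a = u b
  have : IsTrans (SignedPoint n) r := ⟨fun a b c => by grind⟩
  have hr (i : Fin n) : r (lo i) (hi i) :=
    (hw.dominant i).lt_or_eq.imp_right fun hi => ⟨hi, h i ((hw.eq_iff i).mp hi)⟩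
  have hr_neg (i : Fin n) : r (-hi i) (-lo i) := by
    have := hr i
    simp only [r, hw.odd _, hu _]
    omega
  exact ((rel_of_rel_lo_hi hr hr_neg hab hne).resolve_left hwab.not_lt).2

/-- If `w` vanishes only at a single antipodal pair `± a`, then no generator in `J` forces
`u a = u (-a)`. -/
theorem IsFaceVector.factorsThrough_iff (hw : IsFaceVector w J)
    (h0 : ∀ a, w a = 0 → ∃ b, b ≠ a ∧ b ≠ -a ∧ w b = 0) {u : SignedPoint n → ℤ} (hu : u.Odd) :
    u.FactorsThrough w ↔ ∀ i ∈ J, u (lo i) = u (hi i) := by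
  refine ⟨fun h i hi => h ((hw.eq_iff i).mpr hi), fun h => ?_⟩
  have eq_of_ne_neg {a b : SignedPoint n} (hne : b ≠ -a) (hwab : w a = w b) : u a = u b := by
    rcases lt_trichotomy a b with hab | rfl | hab
    · exact hw.eq_of_fixed_of_lt hu h hab hne hwab
    · rfl
    · exact (hw.eq_of_fixed_of_lt hu h hab (by grind [neg_neg]) hwab.symm).symm
  intro a b hwab
  rcases eq_or_ne b (-a) with rfl | hne
  · have ha : w a = 0 := by
      rw [hw.odd] at hwab
      omega
    obtain ⟨c, hca, hca', hc⟩ := h0 a ha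
    rw [eq_of_ne_neg hca' (ha.trans hc.symm),
      eq_of_ne_neg (by rwa [neg_neg]) (hwab.symm.trans (ha.trans hc.symm))]
  · exact eq_of_ne_neg hne hwab

theorem fixCount_eq_card_fixed (hw : IsFaceVector w J)
    (h0 : ∀ a, w a = 0 → ∃ b, b ≠ a ∧ b ≠ -a ∧ w b = 0) (hv : v.Odd) :
    fixCount v J = (fixed v w).card := by
  classical
  rw [fixCount, fixed]
  congr 1
  exact Finset.filter_congr fun u hu =>
    (hw.factorsThrough_iff h0 ((mem_orbit_iff hv).mp hu).1).symm

end FixedVectors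

section Lists

variable {α : Type*} {l l' : List α}

theorem card_get_eq [DecidableEq α] (l : List α) (c : α) :
    (Finset.univ.filter fun j : Fin l.length => l.get j = c).card = l.count c :=
  Fin.card_filter_univ_eq_vector_get_eq_count c ⟨l, rfl⟩

theorem perm_iff_exists_equiv :
    l.Perm l' ↔ ∃ τ : Fin l.length ≃ Fin l'.length, ∀ j, l.get j = l'.get (τ j) := by
  have := Classical.decEq α
  constructor
  · intro h
    have fiberEquiv (c : α) : Nonempty ({j // l.get j = c} ≃ {j // l'.get j = c}) := by
      rw [← Fintype.card_eq, Fintype.card_subtype, Fintype.card_subtype, card_get_eq,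
        card_get_eq, h.count_eq]
    exact ⟨Equiv.ofFiberEquiv fun c => (fiberEquiv c).some,
      fun j => (Equiv.ofFiberEquiv_map (fun c => (fiberEquiv c).some) j).symm⟩
  · rintro ⟨τ, hτ⟩
    refine List.perm_iff_count.mpr fun c => ?_
    rw [← card_get_eq, ← card_get_eq]
    exact Finset.card_equiv τ fun j => by
      rw [Finset.mem_filter_univ, Finset.mem_filter_univ, hτ]

theorem exists_perm_getD_eq (h : l.Perm l') (d : α) :
    ∃ σ : Equiv.Perm ℕ, ∀ j, l'.getD (σ j) d = l.getD j d := by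
  obtain ⟨τ, hτ⟩ := perm_iff_exists_equiv.mp h
  have hlen := h.length_eq
  refine ⟨Equiv.Perm.viaEmbedding (τ.trans (finCongr hlen.symm)) Fin.valEmbedding, fun j => ?_⟩
  rcases lt_or_ge j l.length with hj | hj
  · rw [← Fin.val_mk hj, ← Fin.valEmbedding_apply, Equiv.Perm.viaEmbedding_apply]
    simpa [hj] using (hτ ⟨j, hj⟩).symm
  · rw [Equiv.Perm.viaEmbedding_apply_of_notMem _ _ _ (by rintro ⟨i, rfl⟩; exact hj.not_gt i.2),
      List.getD_eq_default _ _ hj, List.getD_eq_default _ _ (by omega)]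

theorem exists_perm_pow_eq_one [DecidableEq α] {p : ℕ} [Fact p.Prime] {c : α}
    (hc : p ≤ l.count c) (d : α) :
    ∃ σ : Equiv.Perm ℕ, σ ^ p = 1 ∧ (∀ j, l.getD (σ j) d = l.getD j d) ∧
      ∃ j < l.length, σ j ≠ j := by
  obtain ⟨e⟩ : Nonempty (ZMod p ↪ {j : Fin l.length // l.get j = c}) := by
    apply Function.Embedding.nonempty_of_card_le
    rwa [ZMod.card, Fintype.card_subtype, card_get_eq]
  let ι : ZMod p ↪ ℕ := e.trans ((Function.Embedding.subtype _).trans Fin.valEmbedding)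
  have hι (x : ZMod p) : l.getD (ι x) d = c :=
    (List.getD_eq_getElem l d (e x).1.2).trans (e x).2
  have hσι (x : ZMod p) : Equiv.Perm.viaEmbeddingHom ι (Equiv.addRight 1) (ι x) = ι (x + 1) :=
    Equiv.Perm.viaEmbedding_apply _ _ _
  refine ⟨Equiv.Perm.viaEmbeddingHom ι (Equiv.addRight 1), ?_, fun j => ?_, ι 0, (e 0).1.2, ?_⟩
  · have hpow : Equiv.addRight (1 : ZMod p) ^ p = 1 := by
      ext x
      rw [← Equiv.Perm.iterate_eq_pow, Equiv.coe_addRight, add_right_iterate]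
      simp
    rw [← map_pow, hpow, map_one]
  · by_cases hj : j ∈ Set.range ι
    · obtain ⟨x, rfl⟩ := hj
      rw [hσι, hι, hι]
    · exact congrArg (l.getD · d) (Equiv.Perm.viaEmbedding_apply_of_notMem _ _ _ hj)
  · rw [hσι, zero_add]
    exact ι.injective.ne one_ne_zero

end Lists

section Parts

variable {n : ℕ} {u v w : SignedPoint n → ℤ} {l l' : List ℕ}

/-- The nonzero absolute values of the coordinates of `v` are `1, …, l.length`, and their
multiplicities are given by the list `l`. -/
structure HasParts (v : SignedPoint n → ℤ) (l : List ℕ) : Prop where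
  odd : v.Odd
  pos : ∀ x ∈ l, 0 < x
  mult_eq : ∀ j, mult v (j + 1) = l.getD j 0

namespace HasParts

theorem mult_eq_get (hv : HasParts v l) (j : Fin l.length) : mult v (j + 1) = l.get j := by
  rw [hv.mult_eq, List.getD_eq_getElem _ _ j.2, List.get_eq_getElem]

theorem exists_natAbs_eq (hv : HasParts v l) (j : Fin l.length) :
    ∃ a, (v a).natAbs = j + 1 := by
  rw [← mult_pos_iff hv.odd, hv.mult_eq_get]
  exact hv.pos _ (l.get_mem _)

theorem exists_eq (hv : HasParts v l) (j : Fin l.length) : ∃ a, v a = (j + 1 : ℕ) := by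
  obtain ⟨a, ha⟩ := hv.exists_natAbs_eq j
  rcases Int.natAbs_eq (v a) with h | h
  · exact ⟨a, by rw [h, ha]⟩
  · exact ⟨-a, by rw [hv.odd, h, ha, neg_neg]⟩

theorem exists_natAbs_apply_eq (hv : HasParts v l) {a : SignedPoint n} (ha : v a ≠ 0) :
    ∃ j : Fin l.length, (v a).natAbs = j + 1 := by
  have hpos := Int.natAbs_pos.mpr ha
  have hmult := (mult_pos_iff hv.odd).mpr ⟨a, (Nat.sub_add_cancel hpos).symm⟩
  rw [hv.mult_eq] at hmult
  have hlt : (v a).natAbs - 1 < l.length := by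
    by_contra! hge
    rw [List.getD_eq_default _ _ hge] at hmult
    exact hmult.false
  exact ⟨⟨_, hlt⟩, (Nat.sub_add_cancel hpos).symm⟩

theorem signFlip (hv : HasParts v l) (ε : ℕ → ℤˣ) : HasParts (signFlip ε ∘ v) l where
  odd := (odd_signFlip ε).comp_odd hv.odd
  pos := hv.pos
  mult_eq j := by rw [mult_signFlip, hv.mult_eq]

theorem comp_perm (hv : HasParts v l) {π : Equiv.Perm (SignedPoint n)} (hπ : Function.Odd π) :
    HasParts (v ∘ π) l where
  odd := hv.odd.comp_odd hπ
  pos := hv.pos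
  mult_eq j := by rw [mult_comp_perm hv.odd (hv.odd.comp_odd hπ) j.succ_pos, hv.mult_eq]

/-- The bijection `τ` matches the parts of `u` with those of `w`: as `u` is a function of `w` and
has at least as many parts, different parts of `w` cannot merge. -/
theorem exists_equiv (hu : HasParts u l) (hw : HasParts w l') (h : u.FactorsThrough w)
    (hl : l'.length ≤ l.length) :
    ∃ τ : Fin l.length ≃ Fin l'.length, (∀ j, l.get j = l'.get (τ j)) ∧
      ∀ (j : Fin l.length) b, (u b).natAbs = j + 1 ↔ (w b).natAbs = τ j + 1 := by
  have hzero {b : SignedPoint n} (hb : w b = 0) : u b = 0 := by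
    have := h (a := b) (b := -b) (by rw [hw.odd, hb, neg_zero])
    rw [hu.odd] at this
    omega
  choose a ha using hu.exists_natAbs_eq
  have hτ_exists (j : Fin l.length) : ∃ i : Fin l'.length, (w (a j)).natAbs = i + 1 :=
    hw.exists_natAbs_apply_eq fun h0 => by simpa [hzero h0] using ha j
  choose τ hτ using hτ_exists
  have natAbs_eq {j : Fin l.length} {b : SignedPoint n} (hb : (w b).natAbs = τ j + 1) :
      (u b).natAbs = j + 1 := by
    rcases Int.natAbs_eq_natAbs_iff.mp (hb.trans (hτ j).symm) with hb | hb
    · rw [h hb, ha]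
    · rw [← hw.odd] at hb
      rw [h hb, hu.odd, Int.natAbs_neg, ha]
  have hinj : τ.Injective := fun i j hij => Fin.ext <| by
    have := natAbs_eq (j := j) ((hτ i).trans (by rw [hij]))
    have := ha i
    omega
  have hbij : τ.Bijective := (Fintype.bijective_iff_injective_and_card τ).mpr
    ⟨hinj, le_antisymm (Fintype.card_le_of_injective τ hinj) (by simpa using hl)⟩
  have natAbs_iff (j : Fin l.length) (b : SignedPoint n) :
      (u b).natAbs = j + 1 ↔ (w b).natAbs = τ j + 1 := by
    refine ⟨fun hb => ?_, natAbs_eq⟩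
    obtain ⟨i', hi'⟩ := hw.exists_natAbs_apply_eq (a := b) fun h0 => by simp [hzero h0] at hb
    obtain ⟨i, rfl⟩ := hbij.2 i'
    have hij : i = j := Fin.ext (by have := natAbs_eq hi'; omega)
    rw [hi', hij]
  refine ⟨Equiv.ofBijective τ hbij, fun j => ?_, natAbs_iff⟩
  rw [Equiv.ofBijective_apply, ← hu.mult_eq_get, ← hw.mult_eq_get, mult, mult]
  congr 1
  exact Finset.filter_congr fun b _ => natAbs_iff j b

theorem perm_of_factorsThrough (hu : HasParts u l) (hw : HasParts w l') (h : u.FactorsThrough w)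
    (hl : l'.length ≤ l.length) : l.Perm l' := by
  obtain ⟨τ, hτ, -⟩ := hu.exists_equiv hw h hl
  exact perm_iff_exists_equiv.mpr ⟨τ, hτ⟩

end HasParts

theorem eq_or_eq_neg_of_factorsThrough (hu : u.Odd) (hv : v.Odd) (h : u.FactorsThrough v)
    (hu1 : ∀ a, (u a).natAbs = 1) (hv1 : ∀ a, (v a).natAbs = 1) : u = v ∨ u = -v := by
  have key (a b : SignedPoint n) : u a * v a = u b * v b := by
    rcases Int.natAbs_eq_natAbs_iff.mp ((hv1 a).trans (hv1 b).symm) with hab | hab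
    · rw [hab, h hab]
    · rw [← hv] at hab
      rw [hab, h hab, hu, hv, neg_mul_neg]
  rcases isEmpty_or_nonempty (SignedPoint n) with _ | ⟨⟨b⟩⟩
  · exact Or.inl (Subsingleton.elim _ _)
  have hb := Int.natAbs_mul (u b) (v b)
  rw [hu1, hv1] at hb
  rcases Int.natAbs_eq_iff.mp hb with hb | hb
  · left
    funext a
    have := key a b
    grind
  · right
    funext a
    have := key a b
    grind [Pi.neg_apply]

variable [hn : Fact (2 ≤ n)]

theorem HasParts.of_mem_orbit (hv : HasParts v l) (hu : u ∈ orbit v) : HasParts u l := by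
  obtain ⟨x, rfl⟩ := mem_orbit.mp hu
  exact hv.comp_perm (odd_coxeter x)

theorem permAbs_comp_mem_orbit {σ : Equiv.Perm ℕ} (hu : HasParts u l) (hv : HasParts v l')
    (hσ : ∀ j, l'.getD (σ j) 0 = l.getD j 0) (hs : posSign u = posSign v) :
    permAbs σ ∘ u ∈ orbit v := by
  refine mem_orbit_of_mult_eq ((odd_permAbs σ).comp_odd hu.odd) hv.odd (fun t ht => ?_)
    (by rw [posSign_permAbs, hs])
  obtain ⟨j, hj⟩ := σ.surjective (t - 1)
  obtain rfl : t = σ j + 1 := by omega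
  rw [mult_permAbs, hu.mult_eq, hv.mult_eq, hσ]

theorem HasParts.card_fixed_le (hu : HasParts u l) (hv : HasParts v l') (h : l.Perm l')
    (hs : posSign u = posSign v ∨ posSign v = -posSign u ∧ ∃ x ∈ l, Odd x) :
    (fixed u w).card ≤ (fixed v w).card := by
  obtain ⟨σ, hσ⟩ := exists_perm_getD_eq h 0
  rcases hs with hs | ⟨hs, x, hx, hx_odd⟩
  · exact TypeD.card_fixed_le (permAbs_injective σ) (permAbs_comp_mem_orbit hu hv hσ hs)
  · obtain ⟨j, rfl⟩ := List.mem_iff_get.mp hx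
    refine TypeD.card_fixed_le
      (h := permAbs σ ∘ TypeD.signFlip (Pi.mulSingle (j + 1) (-1)))
      ((permAbs_injective σ).comp (signFlip_involutive _).injective)
      (permAbs_comp_mem_orbit (hu.signFlip _) hv hσ ?_)
    change posSign (TypeD.signFlip _ ∘ u) = _
    rw [posSign_signFlip_mulSingle, hu.mult_eq_get, hx_odd.neg_one_pow, hs, neg_one_mul]

theorem HasParts.dvd_card_fixed (hv : HasParts v l) {p : ℕ} [Fact p.Prime] {c : ℕ}
    (hc : p ≤ l.count c) : p ∣ (fixed v w).card := by
  obtain ⟨σ, hσp, hσ, j, hj, hσj⟩ := exists_perm_pow_eq_one hc 0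
  obtain ⟨a, ha⟩ := hv.exists_eq ⟨j, hj⟩
  refine TypeD.dvd_card_fixed (h := permAbs σ) (a := a) (by rw [iterate_permAbs, hσp, permAbs_one])
    (permAbs_comp_mem_orbit hv hv hσ rfl) fun hfix => hσj ?_
  have habs := natAbs_permAbs σ (z := v a) (by rw [ha]; omega)
  rw [hfix, ha, Int.natAbs_natCast] at habs
  simpa using habs.symm

theorem two_dvd_card_fixed_of_signFlip (hv : v.Odd) {ε : ℕ → ℤˣ}
    (hs : posSign (signFlip ε ∘ v) = posSign v) {a : SignedPoint n} (ha : v a ≠ 0)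
    (hε : ε (v a).natAbs = -1) : 2 ∣ (fixed v w).card := by
  refine dvd_card_fixed (h := signFlip ε) (a := a) (funext (signFlip_involutive ε))
    (mem_orbit_of_mult_eq ((odd_signFlip ε).comp_odd hv) hv (fun t _ => mult_signFlip ε v t) hs) ?_
  rw [signFlip, hε, Units.val_neg, Units.val_one]
  omega

namespace HasParts

theorem two_dvd_card_fixed_of_even (hv : HasParts v l) (j : Fin l.length)
    (h : posSign v = 0 ∨ Even (l.get j)) : 2 ∣ (fixed v w).card := by
  obtain ⟨a, ha⟩ := hv.exists_eq j
  refine two_dvd_card_fixed_of_signFlip (ε := Pi.mulSingle (j + 1) (-1)) hv.odd ?_ (a := a)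
    (by rw [ha]; omega) (by rw [ha, Int.natAbs_natCast]; simp)
  rw [posSign_signFlip_mulSingle, hv.mult_eq_get]
  rcases h with h | h
  · rw [h, mul_zero]
  · rw [h.neg_one_pow, one_mul]

/-- If all parts are odd, then changing the signs of two of them stays inside the orbit. -/
theorem two_dvd_card_fixed (hv : HasParts v l) (hl : l ≠ [])
    (h : posSign v = 0 ∨ l.length ≠ 1 ∨ ∃ x ∈ l, Even x) : 2 ∣ (fixed v w).card := by
  have hlen : 0 < l.length := List.length_pos_iff.mpr hl
  by_cases heven : posSign v = 0 ∨ ∃ x ∈ l, Even x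
  · rcases heven with h0 | ⟨x, hx, hx_even⟩
    · exact hv.two_dvd_card_fixed_of_even ⟨0, hlen⟩ (Or.inl h0)
    · obtain ⟨j, rfl⟩ := List.mem_iff_get.mp hx
      exact hv.two_dvd_card_fixed_of_even j (Or.inr hx_even)
  push Not at heven
  have hlen2 : 1 < l.length := by
    rcases h with h | h | ⟨x, hx, hx_even⟩
    · exact absurd h heven.1
    · omega
    · exact absurd hx_even (heven.2 x hx)
  have hodd (j : Fin l.length) : Odd (mult v (j + 1)) := by
    rw [hv.mult_eq_get, ← Nat.not_even_iff_odd]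
    exact heven.2 _ (l.get_mem _)
  obtain ⟨a, ha⟩ := hv.exists_eq ⟨0, hlen⟩
  refine two_dvd_card_fixed_of_signFlip
    (ε := Pi.mulSingle (0 + 1) (-1) * Pi.mulSingle (1 + 1) (-1)) hv.odd ?_ (a := a)
    (by rw [ha]; omega) (by rw [ha]; rfl)
  rw [signFlip_mul, Function.comp_assoc, posSign_signFlip_mulSingle, mult_signFlip,
    posSign_signFlip_mulSingle, (hodd ⟨0, hlen⟩).neg_one_pow, (hodd ⟨1, hlen2⟩).neg_one_pow,
    neg_one_mul, neg_one_mul, neg_neg]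

theorem card_fixed_self_eq_one {m : ℕ} (hv : HasParts v [m]) (hs : posSign v ≠ 0) (hm : Odd m) :
    (fixed v v).card = 1 := by
  have hone (a : SignedPoint n) : (v a).natAbs = 1 := by
    obtain ⟨j, hj⟩ := hv.exists_natAbs_apply_eq (apply_ne_zero_of_posSign_ne_zero hv.odd hs a)
    rw [hj, Fin.val_eq_zero]
  have hcard : (positives n).card = m := by
    rw [← Finset.filter_true_of_mem (s := positives n) fun a _ => hone a]
    exact hv.mult_eq 0
  rw [Finset.card_eq_one]
  refine ⟨v, Finset.eq_singleton_iff_unique_mem.mpr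
    ⟨mem_fixed.mpr ⟨mem_orbit.mpr ⟨1, rfl⟩, fun _ _ h => h⟩, fun u hu => ?_⟩⟩
  obtain ⟨huv, hfac⟩ := mem_fixed.mp hu
  obtain ⟨hu_odd, -, hsign⟩ := (mem_orbit_iff hv.odd).mp huv
  obtain ⟨x, rfl⟩ := mem_orbit.mp huv
  refine (eq_or_eq_neg_of_factorsThrough hu_odd hv.odd hfac (fun a => hone _) hone).resolve_right
    fun hneg => hs ?_
  rw [hneg, posSign_neg, hcard, hm.neg_one_pow] at hsign
  omega

end HasParts

end Parts

section ValueGroup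

/-- The permutations of the values of `v` that are induced by elements of the permutation group
`G`. -/
def valueGroup {α β : Type*} (G : Subgroup (Equiv.Perm α)) (v : α → β) :
    Subgroup (Equiv.Perm (Set.range v)) where
  carrier := {π | ∃ x ∈ G, Function.Semiconj (Set.rangeFactorization v) x π}
  one_mem' := ⟨1, G.one_mem, Function.Semiconj.id_right⟩
  mul_mem' := by
    rintro π ρ ⟨x, hxG, hx⟩ ⟨y, hyG, hy⟩
    exact ⟨x * y, G.mul_mem hxG hyG, hx.comp_right hy⟩
  inv_mem' := by
    rintro π ⟨x, hxG, hx⟩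
    exact ⟨x⁻¹, G.inv_mem hxG, hx.inverses_right x.right_inv π.left_inv⟩

theorem exists_mem_valueGroup {α β : Type*} [Finite α] {G : Subgroup (Equiv.Perm α)} {v : α → β}
    {x : Equiv.Perm α} (hx : x ∈ G) (h : (v ∘ x).FactorsThrough v) :
    ∃ π ∈ valueGroup G v, Function.Semiconj (Set.rangeFactorization v) x π := by
  let g (r : Set.range v) : Set.range v := Set.rangeFactorization v (x r.2.choose)
  have hg : Function.Semiconj (Set.rangeFactorization v) x g := fun a =>
    Subtype.ext (h (⟨v a, a, rfl⟩ : Set.range v).2.choose_spec).symm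
  have hsurj : g.Surjective := by
    refine Function.Surjective.of_comp (g := Set.rangeFactorization v) ?_
    rw [← hg.comp_eq]
    exact Set.rangeFactorization_surjective.comp x.surjective
  have hbij : g.Bijective := ⟨Finite.injective_iff_surjective.mpr hsurj, hsurj⟩
  exact ⟨Equiv.ofBijective g hbij, ⟨x, hx, hg⟩, hg⟩

variable {n : ℕ} {v : SignedPoint n → ℤ}

theorem card_valueGroup (v : SignedPoint n → ℤ) :
    Nat.card (valueGroup (coxeterGroup n) v) = (fixed v v).card := by
  have hmem (π : valueGroup (coxeterGroup n) v) :
      (fun a => (π.1 (Set.rangeFactorization v a) : ℤ)) ∈ fixed v v := by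
    obtain ⟨π, x, hxG, hx⟩ := π
    refine mem_fixed.mpr ⟨mem_orbit.mpr ⟨⟨x, hxG⟩, funext fun a => congrArg Subtype.val (hx a)⟩,
      fun a b hab => ?_⟩
    have hab : Set.rangeFactorization v a = Set.rangeFactorization v b := Subtype.ext hab
    simp only [hab]
  rw [← Fintype.card_coe, ← Nat.card_eq_fintype_card]
  refine Nat.card_congr (Equiv.ofBijective (fun π => ⟨_, hmem π⟩) ⟨fun π ρ h => ?_, ?_⟩)
  · ext ⟨_, a, rfl⟩
    exact congrFun (congrArg Subtype.val h) a
  · rintro ⟨u, hu⟩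
    obtain ⟨hu, hfac⟩ := mem_fixed.mp hu
    obtain ⟨x, rfl⟩ := mem_orbit.mp hu
    obtain ⟨π, hπG, hπ⟩ := exists_mem_valueGroup x.2 hfac
    exact ⟨⟨π, hπG⟩, Subtype.ext (funext fun a => congrArg Subtype.val (hπ a).symm)⟩

theorem exists_coxeter_of_dvd_card_fixed {p : ℕ} [hp : Fact p.Prime] (h : p ∣ (fixed v v).card) :
    ∃ x : coxeterGroup n, (v ∘ x.1).FactorsThrough v ∧ v ∘ x.1^[p] = v ∧ v ∘ x.1 ≠ v := by
  rw [← card_valueGroup] at h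
  obtain ⟨⟨π, hπ⟩, hord⟩ := exists_prime_orderOf_dvd_card' p h
  rw [Subgroup.orderOf_mk] at hord
  obtain ⟨x, hxG, hx⟩ := hπ
  refine ⟨⟨x, hxG⟩, fun a b hab => ?_, funext fun a => ?_, fun hfix => ?_⟩
  · have hab : Set.rangeFactorization v a = Set.rangeFactorization v b := Subtype.ext hab
    exact congrArg Subtype.val ((hx a).trans ((congrArg π hab).trans (hx b).symm))
  · have hiter := hx.iterate_right p a
    rw [Equiv.Perm.iterate_eq_pow π, ← hord, pow_orderOf_eq_one] at hiter
    rw [← hord]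
    exact congrArg Subtype.val hiter
  · have hπ : π = 1 := by
      ext ⟨_, a, rfl⟩
      exact (congrArg Subtype.val (hx a)).symm.trans (congrFun hfix a)
    rw [hπ, orderOf_one] at hord
    exact hp.out.one_lt.ne hord

variable [hn : Fact (2 ≤ n)]

theorem comp_coxeter_eq_of_natAbs_eq (hv : v.Odd) {x : coxeterGroup n}
    (hfac : (v ∘ x.1).FactorsThrough v) {p : ℕ} (hp : Odd p) (hxp : v ∘ x.1^[p] = v)
    (habs : ∀ a, (v (x.1 a)).natAbs = (v a).natAbs) : v ∘ x.1 = v := by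
  have hsq : v ∘ x.1^[2] = v := by
    funext a
    change v (x.1 (x.1 a)) = v a
    rcases Int.natAbs_eq_natAbs_iff.mp (habs a) with ha | ha
    · exact (hfac ha).trans ha
    · rw [← hv] at ha
      have hxa : v (x.1 (x.1 a)) = v (x.1 (-a)) := hfac ha
      rw [hxa, odd_coxeter, hv, ha, hv, neg_neg]
  have hpow (k : ℕ) : v ∘ (x.1^[2])^[k] = v := by
    induction k with
    | zero => rfl
    | succ k ih => rw [Function.iterate_succ', ← Function.comp_assoc, hsq, ih]
  obtain ⟨k, rfl⟩ := hp
  rw [← Nat.succ_eq_add_one, Function.iterate_succ, Function.iterate_mul,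
    ← Function.comp_assoc, hpow] at hxp
  exact hxp

/-- Cauchy's theorem yields an element of order `p` that permutes the values of `v`. As `p` is odd,
it permutes their absolute values nontrivially, and the `p` values of an orbit all have the same
multiplicity. -/
theorem HasParts.exists_le_count {l : List ℕ} (hv : HasParts v l) {p : ℕ} [hp : Fact p.Prime]
    (hp2 : p ≠ 2) (h : p ∣ (fixed v v).card) : ∃ c ∈ l, p ≤ l.count c := by
  obtain ⟨x, hfac, hxp, hne⟩ := exists_coxeter_of_dvd_card_fixed h
  obtain ⟨τ, hτ, hτ_iff⟩ :=
    (hv.comp_perm (odd_coxeter x)).exists_equiv hv hfac le_rfl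
  have hτ_iterate (k : ℕ) (j : Fin l.length) (b : SignedPoint n) :
      (v (x.1^[k] b)).natAbs = j + 1 ↔ (v b).natAbs = τ^[k] j + 1 := by
    induction k generalizing b with
    | zero => rfl
    | succ k ih =>
      rw [Function.iterate_succ_apply, ih, Function.iterate_succ_apply', ← hτ_iff,
        Function.comp_apply]
  have hτp (j : Fin l.length) : Function.IsPeriodicPt τ p j := by
    obtain ⟨b, hb⟩ := hv.exists_natAbs_eq j
    have := (hτ_iterate p j b).mp ((congrArg Int.natAbs (congrFun hxp b)).trans hb)
    exact Fin.ext (by omega)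
  obtain ⟨j, hj⟩ : ∃ j, ¬ Function.IsFixedPt τ j := by
    by_contra! hfix
    refine hne (comp_coxeter_eq_of_natAbs_eq hv.odd hfac (hp.out.odd_of_ne_two hp2) hxp fun a => ?_)
    by_cases ha : v a = 0
    · have hxa : v (x.1 a) = v (x.1 (-a)) := hfac (by rw [hv.odd, ha, neg_zero])
      rw [odd_coxeter, hv.odd] at hxa
      omega
    · obtain ⟨j, hj⟩ := hv.exists_natAbs_apply_eq ha
      rw [hj]
      exact (hτ_iff j a).mpr (by rw [hj, hfix j])
  have hcount (k : ℕ) : l.get (τ^[k] j) = l.get j := by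
    induction k with
    | zero => rfl
    | succ k ih => rw [Function.iterate_succ_apply', ← hτ, ih]
  refine ⟨l.get j, l.get_mem j, ?_⟩
  rw [← card_get_eq, ← Finset.card_range p]
  refine Finset.card_le_card_of_injOn (τ^[·] j) (fun k _ => by simpa using hcount k) ?_
  rw [Finset.coe_range, ← Function.minimalPeriod_eq_prime (hτp j) hj]
  exact Function.iterate_injOn_Iio_minimalPeriod

end ValueGroup

namespace DComposition

variable {n : ℕ}

theorem natAbs_vector_eq_succ_iff (κ : DComposition n) {a : SignedPoint n} (ha : 0 < (a : ℤ))
    {j : ℕ} (hj : j < κ.composition.length) : (κ.vector a).natAbs = j + 1 ↔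
      (a : ℤ) ∈ Finset.Ioc ((κ.offset + κ.composition.sizeUpTo j : ℕ) : ℤ)
        (κ.offset + κ.composition.sizeUpTo (j + 1) : ℕ) := by
  have := κ.offset_add_total
  have := a.2
  rw [natAbs_vector, level_eq_succ_iff _ (by omega) hj, Finset.mem_Ioc]
  omega

theorem mult_vector (κ : DComposition n) {j : ℕ} (hj : j < κ.composition.length) :
    mult κ.vector (j + 1) = κ.composition.blocks[j] := by
  have hsum := κ.offset_add_total
  have hsucc := κ.composition.sizeUpTo_succ hj
  have hle := κ.composition.sizeUpTo_le (j + 1)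
  have hblock : κ.composition.blocks[j] =
      (Finset.Ioc ((κ.offset + κ.composition.sizeUpTo j : ℕ) : ℤ)
        (κ.offset + κ.composition.sizeUpTo (j + 1) : ℕ)).card := by
    rw [Int.card_Ioc]
    omega
  rw [hblock]
  refine Finset.card_nbij (fun a => (a : ℤ)) (fun a ha => ?_) Subtype.val_injective.injOn
    fun b hb => ?_
  · obtain ⟨hapos, ha⟩ := Finset.mem_filter.mp ha
    exact (κ.natAbs_vector_eq_succ_iff (mem_positives.mp hapos) hj).mp ha
  · have hb' := Finset.mem_Ioc.mp hb
    have hbpos : 0 < b := by omega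
    refine ⟨⟨b, by omega⟩, Finset.mem_filter.mpr ⟨mem_positives.mpr hbpos, ?_⟩, rfl⟩
    exact (κ.natAbs_vector_eq_succ_iff hbpos hj).mpr hb

theorem hasParts_vector (κ : DComposition n) : HasParts κ.vector κ.components where
  odd := κ.odd_vector
  pos x hx := κ.composition.blocks_pos (by rwa [blocks_composition])
  mult_eq j := by
    rw [← blocks_composition]
    rcases lt_or_ge j κ.composition.length with hj | hj
    · rw [List.getD_eq_getElem _ _ hj, mult_vector κ hj]
    · rw [List.getD_eq_default _ _ hj, mult, Finset.card_eq_zero, Finset.filter_eq_empty_iff]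
      intro a _
      have := level_le κ.composition κ.offset (a : ℤ).natAbs
      rw [natAbs_vector]
      omega

theorem sum_components (κ : DComposition n) : κ.components.sum = κ.total := by
  rw [← blocks_composition, Composition.blocks_sum]

theorem two_le_offset {κ : DComposition n} (h : κ.offset ≠ 0) : 2 ≤ κ.offset := by
  cases κ <;> simp only [offset] at h ⊢ <;> omega

theorem vector_eq_zero {κ : DComposition n} {a : SignedPoint n}
    (ha : (a : ℤ).natAbs ≤ κ.offset) : κ.vector a = 0 := by
  rw [← Int.natAbs_eq_zero, natAbs_vector, level_eq_zero _ ha]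

theorem posSign_vector_of_offset_ne_zero {κ : DComposition n} (h : κ.offset ≠ 0) :
    posSign κ.vector = 0 := by
  have := two_le_offset h
  have := κ.offset_add_total
  refine Finset.prod_eq_zero (i := ⟨1, by omega⟩) (by simp) ?_
  rw [vector_eq_zero (by simp only; omega), Int.sign_zero]

variable [hn : Fact (2 ≤ n)]

theorem posSign_vector_of_not_isDual {κ : DComposition n} (hoffset : κ.offset = 0)
    (hdual : ¬ κ.IsDual) : posSign κ.vector = 1 := by
  have := hn.out
  have := κ.offset_add_total
  refine Finset.prod_eq_one fun a ha => ?_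
  have ha := mem_positives.mp ha
  rw [κ.vector_of_pos ha fun h => hdual h.1, hoffset]
  exact Int.sign_eq_one_of_pos (by exact_mod_cast level_pos κ.composition (by omega) (by omega))

theorem posSign_vector_dual (c : Composition n) (h : ∃ a ∈ c.blocks.head?, 2 ≤ a) :
    posSign (dual c h).vector = -1 := by
  have := hn.out
  rw [posSign, Finset.prod_eq_single (⟨1, by omega⟩ : SignedPoint n)]
  · rw [vector_dual_one h rfl, Int.sign_neg, Int.sign_one]
  · intro a ha ha1
    have ha := mem_positives.mp ha
    rw [vector_of_pos _ ha fun h' => ha1 (Subtype.ext h'.2)]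
    exact Int.sign_eq_one_of_pos (by exact_mod_cast level_pos c (by omega) (by omega))
  · simp

theorem posSign_vector_of_isDual {κ : DComposition n} (h : κ.IsDual) : posSign κ.vector = -1 := by
  cases κ with
  | dual c hc => exact posSign_vector_dual c hc
  | _ => exact h.elim

theorem posSign_vector_of_isTop {κ : DComposition n} (h : κ.IsTop) : posSign κ.vector = 1 := by
  cases κ with
  | top c hc => exact posSign_vector_of_not_isDual rfl id
  | _ => exact h.elim

theorem posSign_vector (κ : DComposition n) [Decidable κ.IsDual] :
    posSign κ.vector = if κ.offset = 0 then if κ.IsDual then -1 else 1 else 0 := by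
  split_ifs with hoffset hdual
  · exact posSign_vector_of_isDual hdual
  · exact posSign_vector_of_not_isDual hoffset hdual
  · exact posSign_vector_of_offset_ne_zero hoffset

theorem exists_zero_of_vector_eq_zero (κ : DComposition n) (a : SignedPoint n)
    (ha : κ.vector a = 0) : ∃ b, b ≠ a ∧ b ≠ -a ∧ κ.vector b = 0 := by
  classical
  have := hn.out
  have hoffset : 2 ≤ κ.offset := two_le_offset fun h0 =>
    apply_ne_zero_of_posSign_ne_zero κ.odd_vector
      (by rw [posSign_vector, if_pos h0]; split_ifs <;> decide) a ha
  simp only [Ne, Subtype.ext_iff, coe_neg]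
  by_cases ha1 : (a : ℤ).natAbs = 1
  · exact ⟨⟨2, by omega⟩, by simp only; omega, by simp only; omega, vector_eq_zero (by simpa)⟩
  · exact ⟨⟨1, by omega⟩, by simp only; omega, by simp only; omega,
      vector_eq_zero (by simp only; omega)⟩

end DComposition

namespace DComposition

variable {n : ℕ} {κ ν : DComposition n}

theorem isTop_of_even (hoffset : κ.offset = 0) (hdual : ¬ κ.IsDual)
    (heven : ∀ a ∈ κ.components, Even a) : κ.IsTop := by
  cases κ with
  | below m hm c =>
    simp only [offset] at hoffset
    omega
  | one c hc =>
    obtain ⟨a, ha, rfl⟩ := hc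
    exact absurd (heven 1 (List.mem_of_mem_head? ha)) (by decide)
  | top c hc => trivial
  | dual c hc => exact absurd trivial hdual

namespace Equivalent

theorem symm (h : κ.Equivalent ν) : ν.Equivalent κ :=
  ⟨h.1.symm, fun h' => h.2.2 ⟨h'.2.1, h'.1, fun a ha => h'.2.2 a (h.1.subset ha)⟩,
    fun h' => h.2.1 ⟨h'.2.1, h'.1, fun a ha => h'.2.2 a (h.1.subset ha)⟩⟩

theorem offset_eq (h : κ.Equivalent ν) : κ.offset = ν.offset := by
  have hsum := h.1.sum_eq
  rw [sum_components, sum_components] at hsum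
  have := κ.offset_add_total
  have := ν.offset_add_total
  omega

theorem isDual_iff (h : κ.Equivalent ν) (hoffset : κ.offset = 0)
    (heven : ∀ a ∈ κ.components, Even a) : κ.IsDual ↔ ν.IsDual := by
  have heven' : ∀ a ∈ ν.components, Even a := fun a ha => heven a (h.1.symm.subset ha)
  constructor
  · intro hκ
    by_contra hν
    exact h.2.2 ⟨hκ, isTop_of_even (h.offset_eq ▸ hoffset) hν heven', heven⟩
  · intro hν
    by_contra hκ
    exact h.2.1 ⟨isTop_of_even hoffset hκ heven, hν, heven⟩

variable [Fact (2 ≤ n)]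

theorem posSign_eq_or (h : κ.Equivalent ν) : posSign κ.vector = posSign ν.vector ∨
    posSign ν.vector = -posSign κ.vector ∧ ∃ x ∈ κ.components, Odd x := by
  classical
  by_cases heven : ∀ a ∈ κ.components, Even a
  · left
    rw [posSign_vector, posSign_vector, h.offset_eq]
    by_cases hoffset : ν.offset = 0
    · simp only [h.isDual_iff (h.offset_eq.trans hoffset) heven]
    · rw [if_neg hoffset, if_neg hoffset]
  · push Not at heven
    simp only [Nat.not_even_iff_odd] at heven
    rw [posSign_vector, posSign_vector, h.offset_eq]
    split_ifs <;> simp [heven]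

theorem card_fixed (h : κ.Equivalent ν) (w : SignedPoint n → ℤ) :
    (fixed κ.vector w).card = (fixed ν.vector w).card :=
  le_antisymm (κ.hasParts_vector.card_fixed_le ν.hasParts_vector h.1 h.posSign_eq_or)
    (ν.hasParts_vector.card_fixed_le κ.hasParts_vector h.symm.1 h.symm.posSign_eq_or)

end Equivalent

variable [hn : Fact (2 ≤ n)]

theorem posSign_vector_eq_of_factorsThrough {u : SignedPoint n → ℤ}
    (hu : u ∈ orbit κ.vector) (h : u.FactorsThrough ν.vector)
    (hκ : posSign κ.vector ≠ 0) (hν : posSign ν.vector ≠ 0)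
    (heven : ∀ a ∈ ν.components, Even a) : posSign κ.vector = posSign ν.vector := by
  obtain ⟨hu_odd, -, hsign⟩ := (mem_orbit_iff κ.odd_vector).mp hu
  rw [← hsign]
  refine posSign_eq_of_factorsThrough hu_odd ν.odd_vector h (hsign ▸ hκ) hν fun t ht => ?_
  obtain ⟨j, rfl⟩ := Nat.exists_eq_succ_of_ne_zero ht.ne'
  rw [ν.hasParts_vector.mult_eq]
  rcases lt_or_ge j ν.components.length with hj | hj
  · rw [List.getD_eq_getElem _ _ hj]
    exact heven _ (List.getElem_mem hj)
  · rw [List.getD_eq_default _ _ hj]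
    exact Even.zero

theorem equivalent_of_card_fixed_ne_zero (hl : ν.components.length ≤ κ.components.length)
    (h : (fixed κ.vector ν.vector).card ≠ 0) : κ.Equivalent ν := by
  classical
  obtain ⟨u, hu⟩ := Finset.card_ne_zero.mp h
  obtain ⟨hu, hfac⟩ := mem_fixed.mp hu
  have hperm : κ.components.Perm ν.components :=
    (κ.hasParts_vector.of_mem_orbit hu).perm_of_factorsThrough ν.hasParts_vector hfac hl
  have heven (h : ∀ a ∈ κ.components, Even a) (hκ : posSign κ.vector ≠ 0)
      (hν : posSign ν.vector ≠ 0) : posSign κ.vector = posSign ν.vector :=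
    posSign_vector_eq_of_factorsThrough hu hfac hκ hν fun a ha => h a (hperm.symm.subset ha)
  refine ⟨hperm, fun ⟨hκ, hν, h⟩ => ?_, fun ⟨hκ, hν, h⟩ => ?_⟩
  · rw [posSign_vector_of_isTop hκ, posSign_vector_of_isDual hν] at heven
    exact absurd (heven h (by decide) (by decide)) (by decide)
  · rw [posSign_vector_of_isDual hκ, posSign_vector_of_isTop hν] at heven
    exact absurd (heven h (by decide) (by decide)) (by decide)

theorem eq_empty_of_components_eq_nil (h : κ.components = []) : κ = empty hn.out := by
  have := hn.out
  have hsum := κ.sum_components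
  rw [h, List.sum_nil] at hsum
  cases κ <;> simp only [total] at hsum
  case below m hm c =>
    subst hsum
    rw [empty, show c = Composition.ones 0 from Composition.ext h]
  all_goals omega

theorem eq_single_or (hoffset : κ.offset = 0) (h : κ.components.length = 1) :
    κ = single hn.out ∨ κ = singleDual hn.out := by
  have := hn.out
  obtain ⟨x, hx⟩ := List.length_eq_one_iff.mp h
  have hsum := κ.sum_components
  rw [hx, List.sum_singleton] at hsum
  have eq_single {c : Composition n} (hc : c.blocks = [x]) (hxn : x = n) :
      c = Composition.single n (two_pos.trans_le hn.out) :=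
    Composition.ext (hc.trans (congrArg ([·]) hxn))
  cases κ with
  | below m hm c =>
    simp only [offset] at hoffset
    omega
  | one c hc =>
    obtain ⟨a, ha, rfl⟩ := hc
    rw [show c.blocks = [x] from hx, List.head?_cons, Option.mem_some_iff] at ha
    simp only [total] at hsum
    omega
  | top c hc => exact Or.inl (by simp only [single, eq_single hx hsum])
  | dual c hc => exact Or.inr (by simp only [singleDual, eq_single hx hsum])

theorem card_fixed_empty (w : SignedPoint n → ℤ) :
    (fixed (empty hn.out : DComposition n).vector w).card = 1 := by
  have vector_empty : (empty hn.out : DComposition n).vector = 0 := by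
    funext a
    by_contra ha
    obtain ⟨j, -⟩ := (empty hn.out : DComposition n).hasParts_vector.exists_natAbs_apply_eq ha
    exact j.elim0
  rw [vector_empty, Finset.card_eq_one]
  refine ⟨0, Finset.eq_singleton_iff_unique_mem.mpr
    ⟨mem_fixed.mpr ⟨mem_orbit.mpr ⟨1, rfl⟩, fun _ _ _ => rfl⟩, fun u hu => ?_⟩⟩
  obtain ⟨x, rfl⟩ := mem_orbit.mp (mem_fixed.mp hu).1
  rfl

theorem card_fixed_vector_empty (h : κ ≠ empty hn.out) :
    (fixed κ.vector (empty hn.out : DComposition n).vector).card = 0 := by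
  by_contra hne
  exact h <| eq_empty_of_components_eq_nil
    (equivalent_of_card_fixed_ne_zero (Nat.zero_le _) hne).1.eq_nil

theorem two_dvd_card_fixed (h : κ ≠ empty hn.out)
    (h' : Even n ∨ κ ≠ single hn.out ∧ κ ≠ singleDual hn.out) (w : SignedPoint n → ℤ) :
    2 ∣ (fixed κ.vector w).card := by
  refine κ.hasParts_vector.two_dvd_card_fixed (mt eq_empty_of_components_eq_nil h) ?_
  by_cases hoffset : κ.offset = 0
  · refine Or.inr (or_iff_not_imp_left.mpr fun hlen => ?_)
    rw [not_not] at hlen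
    have heven : Even n := h'.resolve_right fun hne =>
      (eq_single_or hoffset hlen).elim hne.1 hne.2
    obtain ⟨x, hx⟩ := List.length_eq_one_iff.mp hlen
    have hsum := κ.sum_components
    have := κ.offset_add_total
    rw [hx, List.sum_singleton] at hsum
    exact ⟨x, by rw [hx]; exact List.mem_singleton_self x, by rwa [show x = n by omega]⟩
  · exact Or.inl (posSign_vector_of_offset_ne_zero hoffset)

omit hn in
theorem single_ne_singleDual (hn : 2 ≤ n) : (single hn : DComposition n) ≠ singleDual hn := nofun

theorem single_equivalent_singleDual (hodd : Odd n) :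
    (single hn.out : DComposition n).Equivalent (singleDual hn.out) :=
  ⟨List.Perm.refl _,
    fun h => Nat.not_even_iff_odd.mpr hodd (h.2.2 n List.mem_cons_self), fun h => h.1⟩

theorem card_fixed_single (hodd : Odd n) :
    (fixed (single hn.out : DComposition n).vector
      (single hn.out : DComposition n).vector).card = 1 := by
  refine HasParts.card_fixed_self_eq_one (m := n) (hasParts_vector _) ?_ hodd
  rw [posSign_vector_of_not_isDual rfl id]
  exact one_ne_zero

end DComposition

section Characters

variable {n : ℕ} [hn : Fact (2 ≤ n)]

theorem span_range_B : Submodule.span ℤ (Set.range fun κ : DComposition n => B κ) = ⊤ := by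
  have subset_surjective : (fun κ : DComposition n => κ.subsetᶜ).Surjective :=
    compl_surjective.comp DComposition.exists_subset_eq
  rw [← span_rep, ← subset_surjective.range_comp]
  rfl

variable (p : ℕ)

theorem character_Bbar (κ ν : DComposition n) :
    character p ν.subsetᶜ (Bbar p κ) = ((fixed κ.vector ν.vector).card : ZMod p) := by
  have hdiag : isTriangular_descentBasis.diagonal ν.subsetᶜ (B κ) =
      (fixed κ.vector ν.vector).card := by
    rw [← fixCount_eq_card_fixed ν.isFaceVector_vector ν.exists_zero_of_vector_eq_zero κ.odd_vector]
    exact diagonal_rep κ.isFaceVector_vector ν.subsetᶜ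
  rw [Bbar, character_mk, hdiag, Int.cast_natCast]

theorem character_linearCombination (ν : DComposition n) (c : DComposition n →₀ ZMod p) :
    character p ν.subsetᶜ (Finsupp.linearCombination (ZMod p) (Bbar p) c) =
      ∑ κ ∈ c.support, c κ * ((fixed κ.vector ν.vector).card : ZMod p) := by
  rw [Finsupp.linearCombination_apply, Finsupp.sum]
  refine (map_sum (character p ν.subsetᶜ).toAddMonoidHom _ _).trans
    (Finset.sum_congr rfl fun κ _ => ?_)
  change character p ν.subsetᶜ (c κ • Bbar p κ) = _
  rw [character_smul, character_Bbar]

theorem exists_linearCombination (x : ModularDescentAlgebra n p) :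
    ∃ c : DComposition n →₀ ZMod p, Finsupp.linearCombination (ZMod p) (Bbar p) c = x := by
  obtain ⟨y, rfl⟩ := Ideal.Quotient.mk_surjective x
  rw [← LinearMap.mem_range, Finsupp.range_linearCombination]
  have span_le : Submodule.span ℤ (Set.range fun κ : DComposition n => B κ) ≤
      AddSubgroup.toIntSubmodule ((Submodule.span (ZMod p) (Set.range (Bbar p))).toAddSubgroup.comap
        (Ideal.Quotient.mk (multiples n p)).toAddMonoidHom) :=
    Submodule.span_le.mpr (Set.range_subset_iff.mpr fun κ => Submodule.subset_span ⟨κ, rfl⟩)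
  have hy : y ∈ Submodule.span ℤ (Set.range fun κ : DComposition n => B κ) := by
    rw [span_range_B]
    trivial
  exact span_le hy

variable [Fact p.Prime]

theorem mem_radical_iff_forall_dComposition {x : ModularDescentAlgebra n p} :
    x ∈ radical n p ↔ ∀ ν : DComposition n, character p ν.subsetᶜ x = 0 := by
  rw [mem_radical_iff]
  refine ⟨fun h ν => h _, fun h J => ?_⟩
  obtain ⟨ν, hν⟩ := DComposition.exists_subset_eq Jᶜ
  rw [← compl_compl J, ← hν]
  exact h ν

theorem Bbar_mem_radical_iff {κ : DComposition n} :
    Bbar p κ ∈ radical n p ↔ ∀ ν : DComposition n, p ∣ (fixed κ.vector ν.vector).card := by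
  simp only [mem_radical_iff_forall_dComposition, character_Bbar, ZMod.natCast_eq_zero_iff]

end Characters

theorem span_subset_radical {n : ℕ} (p : ℕ) {S : Set (ModularDescentAlgebra n p)}
    (hS : S ⊆ radical n p) :
    (Submodule.span (ZMod p) S : Set (ModularDescentAlgebra n p)) ⊆ radical n p :=
  Submodule.span_le (p := AddSubgroup.toZModSubmodule p (radical n p).toAddSubgroup).mpr hS

section RadicalMembers

variable {n : ℕ} [hn : Fact (2 ≤ n)] (p : ℕ) [Fact p.Prime] {κ ν : DComposition n}

theorem Bbar_sub_mem_radical (h : κ.Equivalent ν) : Bbar p κ - Bbar p ν ∈ radical n p := by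
  rw [mem_radical_iff_forall_dComposition]
  intro w
  rw [RingHom.map_sub, character_Bbar, character_Bbar, h.card_fixed, sub_self]

theorem Bbar_mem_radical_of_hasMultiplicityAtLeast (h : κ.HasMultiplicityAtLeast p) :
    Bbar p κ ∈ radical n p := by
  obtain ⟨a, -, ha⟩ := h
  exact (Bbar_mem_radical_iff p).mpr fun _ => κ.hasParts_vector.dvd_card_fixed ha

theorem Bbar_two_mem_radical (h : κ ≠ DComposition.empty hn.out)
    (h' : Even n ∨ κ ≠ DComposition.single hn.out ∧ κ ≠ DComposition.singleDual hn.out) :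
    Bbar 2 κ ∈ radical n 2 :=
  (Bbar_mem_radical_iff 2).mpr fun w => DComposition.two_dvd_card_fixed h h' w.vector

end RadicalMembers

section OddCharacteristic

variable {n p : ℕ}

/-- The elements of part 1 of the theorem, which span the radical for `p ≠ 2`. -/
def oddGenerators (n p : ℕ) : Set (ModularDescentAlgebra n p) :=
  {x | ∃ κ ν : DComposition n, κ.Equivalent ν ∧ x = Bbar p κ - Bbar p ν} ∪
    {x | ∃ κ : DComposition n, κ.HasMultiplicityAtLeast p ∧ x = Bbar p κ}

/-- A combination of the `Bbar p κ` is reduced if no element of `oddGenerators n p` can be used to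
shorten it: its support holds at most one member of each class of `≈`, and none with a component
of multiplicity at least `p`. -/
structure IsReduced (c : DComposition n →₀ ZMod p) : Prop where
  not_hasMultiplicityAtLeast : ∀ κ ∈ c.support, ¬ κ.HasMultiplicityAtLeast p
  eq_of_equivalent : ∀ κ ∈ c.support, ∀ ν ∈ c.support, κ.Equivalent ν → κ = ν

theorem exists_isReduced [Fact (2 ≤ n)] (x : ModularDescentAlgebra n p) :
    ∃ c : DComposition n →₀ ZMod p, IsReduced c ∧
      x - Finsupp.linearCombination (ZMod p) (Bbar p) c ∈
        Submodule.span (ZMod p) (oddGenerators n p) := by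
  classical
  set S := Submodule.span (ZMod p) (oddGenerators n p)
  obtain ⟨c₀, rfl⟩ := exists_linearCombination p x
  obtain ⟨c, hc, hmin⟩ := (measure fun c : DComposition n →₀ ZMod p => c.support.card).wf.has_min
    {c | Finsupp.linearCombination (ZMod p) (Bbar p) c₀ -
      Finsupp.linearCombination (ZMod p) (Bbar p) c ∈ S} ⟨c₀, by simp⟩
  have le_card {d : DComposition n →₀ ZMod p}
      (hd : Finsupp.linearCombination (ZMod p) (Bbar p) (c - d) ∈ S) :
      c.support.card ≤ d.support.card := by
    refine not_lt.mp (hmin d ?_)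
    rw [map_sub] at hd
    simpa only [Set.mem_ofPred_eq, sub_add_sub_cancel] using add_mem hc hd
  refine ⟨c, ⟨fun κ hκ hmult => ?_, fun κ hκ ν hν h => ?_⟩, hc⟩
  · refine (Finset.card_erase_lt_of_mem hκ).not_ge ?_
    rw [← Finsupp.support_erase]
    refine le_card ?_
    rw [Finsupp.erase_eq_sub_single, sub_sub_cancel, Finsupp.linearCombination_single]
    exact S.smul_mem _ (Submodule.subset_span (Or.inr ⟨κ, hmult, rfl⟩))
  · by_contra hne
    have hsupport : (c.erase κ + Finsupp.single ν (c κ)).support ⊆ c.support.erase κ := by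
      refine Finsupp.support_add.trans (Finset.union_subset Finsupp.support_erase.le ?_)
      refine Finsupp.support_single_subset.trans (Finset.singleton_subset_iff.mpr ?_)
      exact Finset.mem_erase.mpr ⟨Ne.symm hne, hν⟩
    refine (Finset.card_erase_lt_of_mem hκ).not_ge
      ((le_card ?_).trans (Finset.card_le_card hsupport))
    rw [← sub_sub, Finsupp.erase_eq_sub_single, sub_sub_cancel, map_sub,
      Finsupp.linearCombination_single, Finsupp.linearCombination_single, ← smul_sub]
    exact S.smul_mem _ (Submodule.subset_span (Or.inl ⟨κ, ν, h, rfl⟩))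

theorem IsReduced.eq_zero [Fact (2 ≤ n)] [Fact p.Prime] (hp2 : p ≠ 2)
    {c : DComposition n →₀ ZMod p} (hc : IsReduced c)
    (hrad : Finsupp.linearCombination (ZMod p) (Bbar p) c ∈ radical n p) : c = 0 := by
  by_contra hne
  obtain ⟨ν, hν, hmin⟩ := Finset.exists_min_image c.support (fun κ => κ.components.length)
    (Finsupp.support_nonempty_iff.mpr hne)
  have hchar := (mem_radical_iff_forall_dComposition p).mp hrad ν
  rw [character_linearCombination, Finset.sum_eq_single_of_mem ν hν] at hchar
  · have hdvd := (mul_eq_zero.mp hchar).resolve_left (Finsupp.mem_support_iff.mp hν)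
    obtain ⟨a, ha⟩ :=
      ν.hasParts_vector.exists_le_count hp2 ((ZMod.natCast_eq_zero_iff _ p).mp hdvd)
    exact hc.not_hasMultiplicityAtLeast ν hν ⟨a, ha⟩
  · intro κ hκ hκν
    have hcard : (fixed κ.vector ν.vector).card = 0 := by
      contrapose! hκν
      exact hc.eq_of_equivalent κ hκ ν hν
        (DComposition.equivalent_of_card_fixed_ne_zero (hmin κ hκ) hκν)
    rw [hcard, Nat.cast_zero, mul_zero]

theorem radical_eq_span_of_ne_two [Fact (2 ≤ n)] [Fact p.Prime] (hp2 : p ≠ 2) :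
    (radical n p : Set (ModularDescentAlgebra n p)) =
      Submodule.span (ZMod p) (oddGenerators n p) := by
  have hspan := span_subset_radical p (show oddGenerators n p ⊆ radical n p by
    rintro _ (⟨κ, ν, h, rfl⟩ | ⟨κ, h, rfl⟩)
    · exact Bbar_sub_mem_radical p h
    · exact Bbar_mem_radical_of_hasMultiplicityAtLeast p h)
  refine Set.Subset.antisymm (fun x hx => ?_) hspan
  obtain ⟨c, hc, hxc⟩ := exists_isReduced x
  have hrad : Finsupp.linearCombination (ZMod p) (Bbar p) c ∈ radical n p := by
    simpa only [sub_sub_cancel] using sub_mem hx (hspan hxc)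
  rwa [hc.eq_zero hp2 hrad, map_zero, sub_zero] at hxc

end OddCharacteristic

section CharacteristicTwo

open DComposition

variable {n : ℕ} [hn : Fact (2 ≤ n)]

theorem apply_empty_eq_zero (p : ℕ) [Fact p.Prime] {c : DComposition n →₀ ZMod p}
    (hc : Finsupp.linearCombination (ZMod p) (Bbar p) c ∈ radical n p) :
    c (empty hn.out) = 0 := by
  have hchar := (mem_radical_iff_forall_dComposition p).mp hc (empty hn.out)
  rw [character_linearCombination, Finset.sum_eq_single (empty hn.out)] at hchar
  · rwa [card_fixed_empty, Nat.cast_one, mul_one] at hchar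
  · intro κ _ hκ
    rw [card_fixed_vector_empty hκ, Nat.cast_zero, mul_zero]
  · intro h
    rw [Finsupp.notMem_support_iff.mp h, zero_mul]

theorem apply_single_add_apply_singleDual (hodd : Odd n) {c : DComposition n →₀ ZMod 2}
    (hc : Finsupp.linearCombination (ZMod 2) (Bbar 2) c ∈ radical n 2) :
    c (single hn.out) + c (singleDual hn.out) = 0 := by
  have hempty := apply_empty_eq_zero 2 hc
  have hchar := (mem_radical_iff_forall_dComposition 2).mp hc (single hn.out)
  rw [character_linearCombination,
    Finset.sum_eq_add (single hn.out) (singleDual hn.out) (single_ne_singleDual hn.out),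
    ← (single_equivalent_singleDual hodd).card_fixed, card_fixed_single hodd, Nat.cast_one,
    mul_one, mul_one] at hchar
  · exact hchar
  · intro κ hκ hκ'
    have hκ0 : κ ≠ empty hn.out := by
      rintro rfl
      exact Finsupp.mem_support_iff.mp hκ hempty
    rw [(ZMod.natCast_eq_zero_iff _ 2).mpr (two_dvd_card_fixed hκ0 (Or.inr hκ') _), mul_zero]
  all_goals exact fun h => by rw [Finsupp.notMem_support_iff.mp h, zero_mul]

theorem radical_two_eq_span_of_even (heven : Even n) :
    (radical n 2 : Set (ModularDescentAlgebra n 2)) =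
      Submodule.span (ZMod 2) {x | ∃ κ : DComposition n, κ ≠ empty hn.out ∧ x = Bbar 2 κ} := by
  refine Set.Subset.antisymm (fun x hx => ?_) (span_subset_radical 2 ?_)
  · obtain ⟨c, rfl⟩ := exists_linearCombination 2 x
    refine Submodule.sum_mem _ fun κ hκ =>
      Submodule.smul_mem _ _ (Submodule.subset_span ⟨κ, ?_, rfl⟩)
    rintro rfl
    exact Finsupp.mem_support_iff.mp hκ (apply_empty_eq_zero 2 hx)
  · rintro _ ⟨κ, hκ, rfl⟩
    exact Bbar_two_mem_radical hκ (Or.inl heven)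

theorem radical_two_eq_span_of_odd (hodd : Odd n) :
    (radical n 2 : Set (ModularDescentAlgebra n 2)) =
      Submodule.span (ZMod 2)
        ({x | ∃ κ : DComposition n, κ ≠ empty hn.out ∧ κ ≠ single hn.out ∧
            κ ≠ singleDual hn.out ∧ x = Bbar 2 κ} ∪
          {Bbar 2 (single hn.out) - Bbar 2 (singleDual hn.out)}) := by
  refine Set.Subset.antisymm (fun x hx => ?_) (span_subset_radical 2 ?_)
  · obtain ⟨c, rfl⟩ := exists_linearCombination 2 x
    set S := Submodule.span (ZMod 2) (_ : Set (ModularDescentAlgebra n 2))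
    have mkQ_single : S.mkQ (Bbar 2 (single hn.out)) = S.mkQ (Bbar 2 (singleDual hn.out)) :=
      (Submodule.Quotient.eq S).mpr (Submodule.subset_span (Or.inr rfl))
    rw [SetLike.mem_coe, ← S.ker_mkQ, LinearMap.mem_ker, Finsupp.linearCombination_apply,
      Finsupp.sum, map_sum, Finset.sum_eq_add (single hn.out) (singleDual hn.out)
        (single_ne_singleDual hn.out), map_smul, map_smul, mkQ_single, ← add_smul,
      apply_single_add_apply_singleDual hodd hx, zero_smul]
    · rintro κ hκ ⟨hsingle, hdual⟩
      rw [← LinearMap.mem_ker, S.ker_mkQ]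
      refine S.smul_mem _ (Submodule.subset_span (Or.inl ⟨κ, ?_, hsingle, hdual, rfl⟩))
      rintro rfl
      exact Finsupp.mem_support_iff.mp hκ (apply_empty_eq_zero 2 hx)
    all_goals exact fun h => by rw [Finsupp.notMem_support_iff.mp h, zero_smul, map_zero]
  · rintro _ (⟨κ, hempty, hsingle, hdual, rfl⟩ | rfl)
    · exact Bbar_two_mem_radical hempty (Or.inr ⟨hsingle, hdual⟩)
    · exact Bbar_sub_mem_radical 2 (single_equivalent_singleDual hodd)

end CharacteristicTwo

end TypeD

theorem theorem3p1 (n : ℕ) (hn : 2 ≤ n) (p : ℕ) [Fact p.Prime] :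
    -- the integral descent ring is the `ℤ`-span of the `B_κ`
    Submodule.span ℤ (Set.range fun κ : DComposition n => B κ) = ⊤ ∧
    (p ≠ 2 →
      (radical n p : Set (ModularDescentAlgebra n p)) =
        Submodule.span (ZMod p)
          ({x | ∃ κ ν : DComposition n, κ.Equivalent ν ∧ x = Bbar p κ - Bbar p ν} ∪
            {x | ∃ κ : DComposition n, κ.HasMultiplicityAtLeast p ∧ x = Bbar p κ})) ∧
    (p = 2 → Even n →
      (radical n p : Set (ModularDescentAlgebra n p)) =
        Submodule.span (ZMod p)
          {x | ∃ κ : DComposition n, κ ≠ DComposition.empty hn ∧ x = Bbar p κ}) ∧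
    (p = 2 → Odd n →
      (radical n p : Set (ModularDescentAlgebra n p)) =
        Submodule.span (ZMod p)
          ({x | ∃ κ : DComposition n, κ ≠ DComposition.empty hn ∧
              κ ≠ DComposition.single hn ∧ κ ≠ DComposition.singleDual hn ∧ x = Bbar p κ} ∪
            {Bbar p (DComposition.single hn) - Bbar p (DComposition.singleDual hn)})) := by
  have : Fact (2 ≤ n) := ⟨hn⟩
  refine ⟨span_range_B, radical_eq_span_of_ne_two, ?_, ?_⟩
  · rintro rfl heven
    exact radical_two_eq_span_of_even heven
  · rintro rfl hodd
    exact radical_two_eq_span_of_odd hodd
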